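/- Let $n\ge 1$, let $U\subset\mathbb R^n$ be a bounded domain (nonempty, open, connected) with Lipschitz boundary, and let $\mathcal K\subset\mathbb M^{n\times n}$ be a nonempty compact set of real $n\times n$ matrices. Suppose that for some $p\in(1,\tfrac{n}{n-1})$ (with $\tfrac{n}{n-1}=+\infty$ if $n=1$) there is a constant $C>0$ such that for every $u\in W^{1,p}(U,\mathbb R^n)$ $$\min_{\mathbb A\in\mathcal K}\|\nabla u-\mathbb A\|_{L^p(U,\mathbb M^{n\times n})}\le C\,\|\mathrm{dist}(\nabla u,\mathcal K)\|_{L^p(U)}.$$ Then the following hold. 1. (Rigidity for exact solutions.) If $u\in W^{1,\infty}(U,\mathbb R^n)$ and $\nabla u(x)\in\mathcal K$ for a.e. $x\in U$, then $u$ is affine. 2. (Rigidity for approximate solutions.) If $u_j\to u$ weakly* in $W^{1,\infty}(U,\mathbb R^n)$, $\mathrm{dist}(\nabla u_j,\mathcal K)\to0$ in measure in $U$, and for some $\mathbb A\in\mathbb M^{n\times n}$ one has $u_j(x)=\mathbb A x$ on $\partial U$ for all $j$, then $\nabla u_j\to\nabla u$ in measure in $U$ and $u$ is affine. 3. (Strong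 rigidity.) If $u_j\to u$ weakly* in $W^{1,\infty}(U,\mathbb R^n)$ and $\mathrm{dist}(\nabla u_j,\mathcal K)\to0$ in measure in $U$, then $\nabla u_j\to\nabla u$ in measure in $U$ and $u$ is affine. 4. $\mathcal K^{\rm qc}=\mathcal K$, where $$\mathcal K^{\rm qc}:=\{\mathbb A\in\mathbb M^{n\times n}:\ f(\mathbb A)\le\sup_{\mathcal K}f\ \text{ for all quasiconvex } f:\mathbb M^{n\times n}\to\mathbb R\}.$$ Here $f:\mathbb M^{n\times n}\to\mathbb R$ is quasiconvex if it is Borel measurable, locally bounded, and $|B|\,f(\mathbb A)\le\int_B f(\mathbb A+\nabla\varphi)\,dx$ for all $\mathbb A\in\mathbb M^{n\times n}$ and all $\varphi\in W^{1,\infty}_0(B,\mathbb R^n)$, with $B$ the unit ball of $\mathbb R^n$. -/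

import Mathlib

open MeasureTheory Filter Topology
open scoped ENNReal NNReal ContDiff

/-- `ℝⁿ` with the Euclidean norm. -/
abbrev Eucl (n : ℕ) : Type := EuclideanSpace ℝ (Fin n)

/-- Real `n × n` matrices `A`, with entries `A (i, j)` (row `i`, column `j`) and with the
Frobenius norm, that is, the Euclidean norm of the vector of entries. -/
abbrev Mat (n : ℕ) : Type := EuclideanSpace ℝ (Fin n × Fin n)

/-- The matrix-vector product `A x`. -/
noncomputable def Mat.apply {n : ℕ} (A : Mat n) (x : Eucl n) : Eucl n :=
  WithLp.toLp 2 fun i => ∑ j, A (i, j) * x j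

/-- `U` has Lipschitz boundary: near each boundary point, after a rotation, `U` is the strict
subgraph of a Lipschitz function of the variables orthogonal to some unit vector `e`. -/
def HasLipschitzBoundary {n : ℕ} (U : Set (Eucl n)) : Prop :=
  ∀ x₀ ∈ frontier U, ∃ r : ℝ, 0 < r ∧ ∃ e : Eucl n, ‖e‖ = 1 ∧
    ∃ (L : ℝ≥0) (γ : (ℝ ∙ e)ᗮ → ℝ), LipschitzWith L γ ∧
      U ∩ Metric.ball x₀ r =
        {x ∈ Metric.ball x₀ r | inner ℝ x e < γ ((ℝ ∙ e)ᗮ.orthogonalProjectionOnto x)}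

/-- Bounded domains (open, connected, nonempty) with Lipschitz boundary. -/
structure IsBoundedLipschitzDomain {n : ℕ} (U : Set (Eucl n)) : Prop where
  isOpen : IsOpen U
  isConnected : IsConnected U
  isBounded : Bornology.IsBounded U
  lipschitz : HasLipschitzBoundary U

/-- `G` is the weak (distributional) gradient of `u` in the open set `U`, with the convention
`G (i, j) = ∂ⱼ uᵢ`. -/
structure HasWeakGradient {n : ℕ} (U : Set (Eucl n)) (u : Eucl n → Eucl n)
    (G : Eucl n → Mat n) : Prop where
  locallyIntegrable : LocallyIntegrableOn u U volume
  locallyIntegrable_grad : LocallyIntegrableOn G U volume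
  integral_eq : ∀ φ : Eucl n → ℝ, ContDiff ℝ ∞ φ → HasCompactSupport φ → tsupport φ ⊆ U →
    ∀ i j : Fin n,
      ∫ x in U, u x i * fderiv ℝ φ x (EuclideanSpace.single j 1) = - ∫ x in U, G x (i, j) * φ x

/-- `u ∈ W^{1,p}(U, ℝⁿ)` with weak gradient `∇u = G`. -/
structure MemW1 {n : ℕ} (p : ℝ≥0∞) (U : Set (Eucl n)) (u : Eucl n → Eucl n)
    (G : Eucl n → Mat n) : Prop where
  memLp : MemLp u p (volume.restrict U)
  memLp_grad : MemLp G p (volume.restrict U)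
  weakGradient : HasWeakGradient U u G

/-- The `L^p` quantitative rigidity estimate on `U`: for some constant `C > 0`, every
`u ∈ W^{1,p}(U, ℝⁿ)` satisfies
`min_{A ∈ K} ‖∇u - A‖_{L^p(U)} ≤ C ‖dist(∇u, K)‖_{L^p(U)}`. -/
def QuantRigidityEstimate {n : ℕ} (p : ℝ≥0∞) (U : Set (Eucl n)) (K : Set (Mat n)) : Prop :=
  ∃ C : ℝ, 0 < C ∧ ∀ (u : Eucl n → Eucl n) (G : Eucl n → Mat n), MemW1 p U u G →
    ∃ A ∈ K, eLpNorm (fun x => G x - A) p (volume.restrict U) ≤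
      ENNReal.ofReal C * eLpNorm (fun x => Metric.infDist (G x) K) p (volume.restrict U)

/-- `u` is (almost everywhere equal to) an affine map on `U`. -/
def IsAffineOn {n : ℕ} (U : Set (Eucl n)) (u : Eucl n → Eucl n) : Prop :=
  ∃ (A : Mat n) (b : Eucl n), ∀ᵐ x ∂(volume.restrict U), u x = Mat.apply A x + b

/-- `u_k → u` weakly* in `W^{1,∞}(U, ℝⁿ)`: all the maps lie in `W^{1,∞}(U, ℝⁿ)`, with gradients
`Gs k` and `G`, and functions and gradients converge weakly* in `L^∞(U)`, that is, when tested
against every integrable function on `U`. -/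
structure WeakStarTendstoW1 {n : ℕ} (U : Set (Eucl n))
    (us : ℕ → Eucl n → Eucl n) (Gs : ℕ → Eucl n → Mat n)
    (u : Eucl n → Eucl n) (G : Eucl n → Mat n) : Prop where
  mem : ∀ k, MemW1 ∞ U (us k) (Gs k)
  mem_limit : MemW1 ∞ U u G
  tendsto : ∀ g : Eucl n → ℝ, IntegrableOn g U volume → ∀ i : Fin n,
    Tendsto (fun k => ∫ x in U, g x * us k x i) atTop (𝓝 (∫ x in U, g x * u x i))
  tendsto_grad : ∀ g : Eucl n → ℝ, IntegrableOn g U volume → ∀ i j : Fin n,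
    Tendsto (fun k => ∫ x in U, g x * Gs k x (i, j)) atTop (𝓝 (∫ x in U, g x * G x (i, j)))

/-- `u(x) = A x` on `∂U`: the representative of `u` that is continuous up to the boundary takes
these boundary values. -/
def HasLinearBoundaryValues {n : ℕ} (U : Set (Eucl n)) (u : Eucl n → Eucl n) (A : Mat n) : Prop :=
  ∃ v : Eucl n → Eucl n, ContinuousOn v (closure U) ∧
    (∀ᵐ x ∂(volume.restrict U), v x = u x) ∧
    ∀ x ∈ frontier U, v x = Mat.apply A x

/-- `∇u ∈ K` is rigid for exact solutions. -/
def RigidExact {n : ℕ} (U : Set (Eucl n)) (K : Set (Mat n)) : Prop :=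
  ∀ (u : Eucl n → Eucl n) (G : Eucl n → Mat n), MemW1 ∞ U u G →
    (∀ᵐ x ∂(volume.restrict U), G x ∈ K) → IsAffineOn U u

/-- `∇u ∈ K` is rigid for approximate solutions. -/
def RigidApprox {n : ℕ} (U : Set (Eucl n)) (K : Set (Mat n)) : Prop :=
  ∀ (us : ℕ → Eucl n → Eucl n) (Gs : ℕ → Eucl n → Mat n)
    (u : Eucl n → Eucl n) (G : Eucl n → Mat n),
    WeakStarTendstoW1 U us Gs u G →
    TendstoInMeasure (volume.restrict U) (fun k x => Metric.infDist (Gs k x) K) atTop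
      (fun _ => (0 : ℝ)) →
    (∃ A : Mat n, ∀ k, HasLinearBoundaryValues U (us k) A) →
    TendstoInMeasure (volume.restrict U) Gs atTop G ∧ IsAffineOn U u

/-- `∇u ∈ K` is strongly rigid. -/
def StronglyRigid {n : ℕ} (U : Set (Eucl n)) (K : Set (Mat n)) : Prop :=
  ∀ (us : ℕ → Eucl n → Eucl n) (Gs : ℕ → Eucl n → Mat n)
    (u : Eucl n → Eucl n) (G : Eucl n → Mat n),
    WeakStarTendstoW1 U us Gs u G →
    TendstoInMeasure (volume.restrict U) (fun k x => Metric.infDist (Gs k x) K) atTop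
      (fun _ => (0 : ℝ)) →
    TendstoInMeasure (volume.restrict U) Gs atTop G ∧ IsAffineOn U u

/-- `φ ∈ W^{1,∞}_0(D, ℝⁿ)` with gradient `G`, for a bounded open set `D` with Lipschitz boundary:
the extension of `φ` by zero belongs to `W^{1,∞}(ℝⁿ, ℝⁿ)`. -/
def MemW1InftyZero {n : ℕ} (D : Set (Eucl n)) (φ : Eucl n → Eucl n) (G : Eucl n → Mat n) : Prop :=
  MemW1 ∞ Set.univ φ G ∧ ∀ᵐ x, x ∉ D → φ x = 0

/-- Quasiconvexity of `f : M^{n×n} → ℝ`: `f` is Borel measurable, locally bounded, and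
`|B| f(A) ≤ ∫_B f(A + ∇φ) dx` for every matrix `A` and every `φ ∈ W^{1,∞}_0(B, ℝⁿ)`, where `B` is
the unit ball of `ℝⁿ`. -/
structure IsQuasiconvex {n : ℕ} (f : Mat n → ℝ) : Prop where
  borel_measurable : Measurable f
  locally_bounded : ∀ R : ℝ, ∃ M : ℝ, ∀ A : Mat n, ‖A‖ ≤ R → |f A| ≤ M
  le_integral : ∀ (A : Mat n) (φ : Eucl n → Eucl n) (G : Eucl n → Mat n),
    MemW1InftyZero (Metric.ball 0 1) φ G →
    volume.real (Metric.ball (0 : Eucl n) 1) * f A ≤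
      ∫ x in Metric.ball (0 : Eucl n) 1, f (A + G x)

/-- The quasiconvex hull `K^qc` of a set of matrices. -/
def quasiconvexHull {n : ℕ} (K : Set (Mat n)) : Set (Mat n) :=
  {A | ∀ f : Mat n → ℝ, IsQuasiconvex f → f A ≤ sSup (f '' K)}

/-! Exact solutions. If `∇u ∈ K` a.e., the right-hand side of the estimate vanishes, so `∇u` equals
a single matrix `A ∈ K` a.e.; then `u - A x` has zero distributional gradient on a connected open
set and is constant.

Strong rigidity, which contains the approximate case. Weak* convergence bounds the gradients
uniformly (Banach–Steinhaus), so `dist(∇u_k, K) → 0` in measure improves to convergence in `L^p`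
(Vitali). The estimate yields `A_k ∈ K` with `∇u_k - A_k → 0` in `L^p`. The means of `∇u_k` converge
by weak* convergence, so `A_k` converges to some `A'`. Thus `∇u_k → A'` strongly, the weak* limit
`∇u` must be `A'`, and `u` is affine.

Quasiconvex hull. Let `F = dist(·, K)^p` and let `qcEnvelope F` be the infimum of `∫_B F(X + ∇ψ)`
over test maps. It is quasiconvex and vanishes on `K`, hence it vanishes at every `A` in the hull.
Relaxation on `U` then gives test maps `ψ` for which `∫_U F(A + ∇ψ)` is arbitrarily small, and the
estimate puts `A + ∇ψ` close in `L^p` to some `A' ∈ K`. Since `∇ψ` has mean zero, taking means gives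
that `A` is close to `A'`; as `K` is closed, `A ∈ K`.

The main work is the relaxation lemma `exists_setIntegral_le_qcEnvelope_add`: `U` is filled, up to
small measure, by finitely many disjoint balls centred at Lebesgue points of the given field, each
carrying a rescaled near-optimal test map. It serves twice: it transfers the envelope from the ball
to `U`, and it proves that the envelope is quasiconvex. -/

/-! ### Constancy theorem for vanishing distributional derivatives -/

section Constancy

variable {E : Type*} [NormedAddCommGroup E] [NormedSpace ℝ E] [FiniteDimensional ℝ E]
  [MeasurableSpace E] [BorelSpace E] {μ : Measure E} [μ.IsAddHaarMeasure]

/-- Mollifications of a function with vanishing distributional derivative have vanishing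
derivative. -/
theorem hasFDerivAt_convolution_of_forall_integral_fderiv_eq_zero {U V : Set E} {w : E → ℝ}
    (hV : MeasurableSet V) (hVU : V ⊆ U) (hw : IntegrableOn w V μ)
    (h : ∀ φ : E → ℝ, ContDiff ℝ ∞ φ → HasCompactSupport φ → tsupport φ ⊆ U →
      ∀ v : E, ∫ x in U, w x * fderiv ℝ φ x v ∂μ = 0)
    (hU : MeasurableSet U) (ρ : ContDiffBump (0 : E)) {x : E}
    (hx : Metric.closedBall x ρ.rOut ⊆ V) :
    HasFDerivAt (convolution (ρ.normed μ) (V.indicator w) (ContinuousLinearMap.lsmul ℝ ℝ) μ)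
      (0 : E →L[ℝ] ℝ) x := by
  have hint : Integrable (V.indicator w) μ := (integrable_indicator_iff hV).2 hw
  have hloc := hint.locallyIntegrable
  have hc := ρ.hasCompactSupport_normed (μ := μ)
  have hd : ContDiff ℝ 1 (ρ.normed μ) := ρ.contDiff_normed (n := 1)
  have key := hc.hasFDerivAt_convolution_left (ContinuousLinearMap.lsmul ℝ ℝ) hd hloc x
  suffices hz : convolution (fderiv ℝ (ρ.normed μ)) (V.indicator w)
      ((ContinuousLinearMap.lsmul ℝ ℝ : ℝ →L[ℝ] ℝ →L[ℝ] ℝ).precompL E) μ x = 0 by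
    rwa [hz] at key
  ext v
  have hex := (hc.fderiv ℝ).convolutionExists_left
    ((ContinuousLinearMap.lsmul ℝ ℝ : ℝ →L[ℝ] ℝ →L[ℝ] ℝ).precompL E)
    (hd.continuous_fderiv one_ne_zero) hloc x
  rw [convolution_eq_swap]
  rw [ContinuousLinearMap.integral_apply hex.integrable_swap]
  simp only [ContinuousLinearMap.precompL_apply, ContinuousLinearMap.lsmul_apply,
    zero_apply, smul_eq_mul]
  -- The mollifier reflected and centred at `x` is an admissible test function, because its support
  -- lies in `closedBall x ρ.rOut ⊆ V ⊆ U`. The derivative of the convolution is minus the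
  -- hypothesis tested on it.
  set φ : E → ℝ := fun t => ρ.normed μ (x - t) with hφ
  have hφd : ContDiff ℝ ∞ φ :=
    (ρ.contDiff_normed (n := ⊤)).comp (contDiff_const.sub contDiff_id)
  have hsupp : tsupport φ ⊆ Metric.closedBall x ρ.rOut := by
    refine closure_minimal ?_ Metric.isClosed_closedBall
    intro t ht
    have : x - t ∈ Function.support (ρ.normed μ) := ht
    rw [ρ.support_normed_eq, Metric.mem_ball, dist_zero_right] at this
    rw [Metric.mem_closedBall, dist_comm, dist_eq_norm]
    exact this.le
  have hφc : HasCompactSupport φ :=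
    (isCompact_closedBall x ρ.rOut).of_isClosed_subset (isClosed_tsupport φ) hsupp
  have hfd : ∀ t, fderiv ℝ φ t v = - fderiv ℝ (ρ.normed μ) (x - t) v := by
    intro t
    have h1 : HasFDerivAt (ρ.normed μ) (fderiv ℝ (ρ.normed μ) (x - t)) (x - t) :=
      (hd.differentiable one_ne_zero _).hasFDerivAt
    have h2 : HasFDerivAt (fun t : E => x - t) (-ContinuousLinearMap.id ℝ E) t := by
      simpa using (hasFDerivAt_id t).const_sub x
    have h3 : HasFDerivAt φ _ t := h1.comp t h2
    rw [h3.fderiv]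
    simp
  have h0 := h φ hφd hφc ((hsupp.trans hx).trans hVU) v
  rw [← integral_indicator hU] at h0
  rw [← neg_eq_zero, ← integral_neg, ← h0]
  congr 1
  ext t
  by_cases ht : t ∈ V
  · simp [Set.indicator_of_mem ht, Set.indicator_of_mem (hVU ht), hfd, mul_comm]
  · have : fderiv ℝ φ t = 0 := by
      by_contra hne
      exact ht (hx (hsupp (support_fderiv_subset ℝ hne)))
    by_cases htU : t ∈ U <;> simp [Set.indicator_of_notMem ht, htU, this]

/-- Mollifications at scales tending to zero have zero derivative on a fixed ball, so each is
constant there; they converge a.e. to `w`, and convergence at one point determines the limit of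
these constants. -/
theorem exists_ae_eq_const_ball_of_forall_integral_fderiv_eq_zero {U : Set E} {w : E → ℝ}
    (hU : IsOpen U) (hw : LocallyIntegrableOn w U μ)
    (h : ∀ φ : E → ℝ, ContDiff ℝ ∞ φ → HasCompactSupport φ → tsupport φ ⊆ U →
      ∀ v : E, ∫ x in U, w x * fderiv ℝ φ x v ∂μ = 0) {x₀ : E} (hx₀ : x₀ ∈ U) :
    ∃ δ > 0, ∃ c : ℝ, ∀ᵐ x ∂μ, x ∈ Metric.ball x₀ δ → w x = c := by
  obtain ⟨r, hr, hrU⟩ := Metric.nhds_basis_closedBall.mem_iff.1 (hU.mem_nhds hx₀)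
  set V := Metric.closedBall x₀ r
  have hwV : IntegrableOn w V μ :=
    hw.integrableOn_compact_subset hrU (isCompact_closedBall _ _)
  have hV : MeasurableSet V := measurableSet_closedBall
  -- Outer radii at most `r / 2` keep the kernels centred in the half ball inside `V`; the fixed
  -- ratio 2 of outer to inner radius is what a.e. convergence of the mollifications requires.
  let ρ : ℕ → ContDiffBump (0 : E) := fun k =>
    ⟨r / 2 / (k + 1) / 2, r / 2 / (k + 1), by positivity, by
      have : 0 < r / 2 / ((k : ℝ) + 1) := by positivity
      linarith⟩
  have hρle : ∀ k, (ρ k).rOut ≤ r / 2 := fun k =>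
    div_le_self (by positivity) (by linarith [(Nat.cast_nonneg k : (0 : ℝ) ≤ k)])
  have hρ0 : Tendsto (fun k => (ρ k).rOut) atTop (𝓝 0) :=
    tendsto_const_nhds.div_atTop (tendsto_atTop_add_const_right _ _ tendsto_natCast_atTop_atTop)
  have hlim := ContDiffBump.ae_convolution_tendsto_right_of_locallyIntegrable (μ := μ)
    (g := V.indicator w) (K := 2) hρ0
    (Eventually.of_forall fun k => by
      change r / 2 / ((k : ℝ) + 1) ≤ 2 * (r / 2 / (k + 1) / 2); linarith)
    ((integrable_indicator_iff hV).2 hwV).locallyIntegrable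
  set W := fun k => convolution ((ρ k).normed μ) (V.indicator w) (ContinuousLinearMap.lsmul ℝ ℝ) μ
  have hball : ∀ x ∈ Metric.ball x₀ (r / 2), ∀ k, Metric.closedBall x (ρ k).rOut ⊆ V := by
    intro x hx k
    refine Metric.closedBall_subset_closedBall' ?_
    have := Metric.mem_ball.1 hx
    linarith [hρle k]
  have hconst : ∀ k, ∀ x ∈ Metric.ball x₀ (r / 2), ∀ y ∈ Metric.ball x₀ (r / 2),
      W k x = W k y := by
    intro k x hx y hy
    have hder : ∀ z ∈ Metric.ball x₀ (r / 2), HasFDerivAt (W k) (0 : E →L[ℝ] ℝ) z :=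
      fun z hz => hasFDerivAt_convolution_of_forall_integral_fderiv_eq_zero hV hrU hwV h
        hU.measurableSet (ρ k) (hball z hz k)
    exact Metric.isOpen_ball.is_const_of_fderiv_eq_zero (convex_ball _ _).isPreconnected
      (fun z hz => (hder z hz).differentiableAt.differentiableWithinAt)
      (fun z hz => (hder z hz).fderiv) hx hy
  obtain ⟨y, hy, hylim⟩ : ∃ y ∈ Metric.ball x₀ (r / 2),
      Tendsto (fun k => W k y) atTop (𝓝 (V.indicator w y)) := by
    have hfreq : ∃ᵐ y ∂μ, y ∈ Metric.ball x₀ (r / 2) := by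
      rw [frequently_ae_mem_iff]
      exact (Metric.measure_ball_pos μ x₀ (by positivity)).ne'
    obtain ⟨y, hy⟩ := (hfreq.and_eventually hlim).exists
    exact ⟨y, hy.1, hy.2⟩
  refine ⟨r / 2, by positivity, V.indicator w y, ?_⟩
  filter_upwards [hlim] with x hx hxb
  have hxV : x ∈ V := Metric.ball_subset_closedBall (Metric.ball_subset_ball (by linarith) hxb)
  have h1 : Tendsto (fun k => W k x) atTop (𝓝 (V.indicator w y)) := by
    simpa only [hconst _ x hxb y hy] using hylim
  rw [← Set.indicator_of_mem hxV w]
  exact tendsto_nhds_unique hx h1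

/-- The constancy theorem: a locally integrable function on a connected open set with vanishing
distributional derivative is almost everywhere constant. -/
theorem exists_ae_eq_const_of_forall_integral_fderiv_eq_zero {U : Set E} {w : E → ℝ}
    (hU : IsOpen U) (hUc : IsConnected U) (hw : LocallyIntegrableOn w U μ)
    (h : ∀ φ : E → ℝ, ContDiff ℝ ∞ φ → HasCompactSupport φ → tsupport φ ⊆ U →
      ∀ v : E, ∫ x in U, w x * fderiv ℝ φ x v ∂μ = 0) :
    ∃ c : ℝ, ∀ᵐ x ∂(μ.restrict U), w x = c := by
  have loc := fun x (hx : x ∈ U) =>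
    exists_ae_eq_const_ball_of_forall_integral_fderiv_eq_zero hU hw h hx
  obtain ⟨x₀, hx₀⟩ := hUc.nonempty
  obtain ⟨δ₀, hδ₀, c, hc⟩ := loc x₀ hx₀
  -- `S T` collects the points near which `w` is a.e. constant with value in `T`. The open sets for
  -- `{c}` and its complement are disjoint and cover `U`, so connectedness leaves only the first.
  let S : Set ℝ → Set E := fun T =>
    {x | ∃ δ > 0, ∃ a ∈ T, ∀ᵐ y ∂μ, y ∈ Metric.ball x δ → w y = a}
  have hS : ∀ T, IsOpen (S T) := by
    intro T
    rw [Metric.isOpen_iff]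
    rintro x ⟨δ, hδ, a, ha, hx⟩
    refine ⟨δ / 2, by positivity, fun y hy => ⟨δ / 2, by positivity, a, ha, ?_⟩⟩
    filter_upwards [hx] with z hz hzy
    refine hz ?_
    have h1 := Metric.mem_ball.1 hzy
    have h2 := Metric.mem_ball.1 hy
    rw [Metric.mem_ball]
    linarith [dist_triangle z y x]
  have hdisj : Disjoint (S {c}) (S {c}ᶜ) := by
    rw [Set.disjoint_left]
    rintro x ⟨δ, hδ, a, ha, hx⟩ ⟨δ', hδ', a', ha', hx'⟩
    have hfreq : ∃ᵐ y ∂μ, y ∈ Metric.ball x (min δ δ') := by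
      rw [frequently_ae_mem_iff]
      exact (Metric.measure_ball_pos μ x (lt_min hδ hδ')).ne'
    obtain ⟨y, hy, hya, hya'⟩ := (hfreq.and_eventually (hx.and hx')).exists
    have e1 := hya (Metric.ball_subset_ball (min_le_left _ _) hy)
    have e2 := hya' (Metric.ball_subset_ball (min_le_right _ _) hy)
    exact ha' (by rw [← e2, e1]; exact ha)
  have hcov : U ⊆ S {c} ∪ S {c}ᶜ := by
    intro x hx
    obtain ⟨δ, hδ, a, ha⟩ := loc x hx
    by_cases hac : a = c
    · exact Or.inl ⟨δ, hδ, a, hac, ha⟩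
    · exact Or.inr ⟨δ, hδ, a, hac, ha⟩
  have hsub : U ⊆ S {c} := hUc.isPreconnected.subset_left_of_subset_union (hS _) (hS _) hdisj hcov
    ⟨x₀, hx₀, δ₀, hδ₀, c, rfl, hc⟩
  refine ⟨c, ?_⟩
  rw [ae_restrict_iff' hU.measurableSet, ae_iff]
  refine measure_null_of_locally_null _ fun x hx => ?_
  simp only [Set.mem_ofPred_eq, Classical.not_imp] at hx
  obtain ⟨δ, hδ, a, ha, hxa⟩ := hsub hx.1
  rw [Set.mem_singleton_iff] at ha
  subst ha
  refine ⟨Metric.ball x δ ∩ {y | ¬ (y ∈ U → w y = a)},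
    Filter.inter_mem (mem_nhdsWithin_of_mem_nhds (Metric.ball_mem_nhds x hδ)) self_mem_nhdsWithin,
    measure_mono_null ?_ (ae_iff.1 hxa)⟩
  rintro y ⟨hy1, hy2⟩
  simp only [Set.mem_ofPred_eq, Classical.not_imp] at hy2 ⊢
  exact ⟨hy1, hy2.2⟩

end Constancy

/-! ### Weak gradients, and affine maps as those with constant gradient -/

section WeakGradient

variable {n : ℕ} {U : Set (Eucl n)} {u v : Eucl n → Eucl n} {G H : Eucl n → Mat n}

theorem MeasureTheory.LocallyIntegrableOn.euclidean_apply {ι : Type*} [Fintype ι]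
    {f : Eucl n → EuclideanSpace ℝ ι} (hf : LocallyIntegrableOn f U volume) (i : ι) :
    LocallyIntegrableOn (fun x => f x i) U volume := fun x hx => by
  obtain ⟨s, hs, hi⟩ := hf x hx
  exact ⟨s, hs, (EuclideanSpace.proj (𝕜 := ℝ) i).integrable_comp hi⟩

theorem MeasureTheory.LocallyIntegrableOn.integrable_mul_of_tsupport_subset {w g : Eucl n → ℝ}
    (hw : LocallyIntegrableOn w U volume) (hg : Continuous g)
    (hgc : HasCompactSupport g) (hgU : tsupport g ⊆ U) :
    Integrable (fun x => w x * g x) volume := by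
  have h1 : IntegrableOn w (tsupport g) volume := hw.integrableOn_compact_subset hgU hgc
  rw [← integrableOn_iff_integrable_of_support_subset (s := tsupport g)]
  · exact h1.mul_continuousOn hg.continuousOn hgc
  · intro x hx
    exact subset_tsupport g fun h0 => hx (by simp [h0])

theorem continuous_fderiv_apply_const {φ : Eucl n → ℝ} (hφ : ContDiff ℝ ∞ φ) (v : Eucl n) :
    Continuous fun x => fderiv ℝ φ x v :=
  (hφ.continuous_fderiv (by simp)).clm_apply continuous_const

theorem HasWeakGradient.integrable_mul_fderiv (h : HasWeakGradient U u G) {φ : Eucl n → ℝ}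
    (hφ : ContDiff ℝ ∞ φ) (hφc : HasCompactSupport φ) (hφU : tsupport φ ⊆ U) (i : Fin n)
    (v : Eucl n) : Integrable (fun x => u x i * fderiv ℝ φ x v) volume :=
  (h.locallyIntegrable.euclidean_apply i).integrable_mul_of_tsupport_subset
    (continuous_fderiv_apply_const hφ v) (hφc.fderiv_apply ℝ v)
    ((tsupport_fderiv_apply_subset ℝ v).trans hφU)

theorem HasWeakGradient.integrable_grad_mul (h : HasWeakGradient U u G) {φ : Eucl n → ℝ}
    (hφ : ContDiff ℝ ∞ φ) (hφc : HasCompactSupport φ) (hφU : tsupport φ ⊆ U) (i : Fin n × Fin n) :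
    Integrable (fun x => G x i * φ x) volume :=
  (h.locallyIntegrable_grad.euclidean_apply i).integrable_mul_of_tsupport_subset
    hφ.continuous hφc hφU

theorem HasWeakGradient.add (hu : HasWeakGradient U u G) (hv : HasWeakGradient U v H) :
    HasWeakGradient U (fun x => u x + v x) (fun x => G x + H x) where
  locallyIntegrable := hu.locallyIntegrable.add hv.locallyIntegrable
  locallyIntegrable_grad := hu.locallyIntegrable_grad.add hv.locallyIntegrable_grad
  integral_eq φ hφ hφc hφU i j := by
    simp only [PiLp.add_apply, add_mul]
    rw [integral_add (hu.integrable_mul_fderiv hφ hφc hφU i _).integrableOn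
        (hv.integrable_mul_fderiv hφ hφc hφU i _).integrableOn,
      integral_add (hu.integrable_grad_mul hφ hφc hφU _).integrableOn
        (hv.integrable_grad_mul hφ hφc hφU _).integrableOn,
      hu.integral_eq φ hφ hφc hφU i j, hv.integral_eq φ hφ hφc hφU i j]
    ring

theorem HasWeakGradient.congr_grad (hu : HasWeakGradient U u G)
    (hGH : G =ᵐ[volume.restrict U] H) : HasWeakGradient U u H where
  locallyIntegrable := hu.locallyIntegrable
  locallyIntegrable_grad := hu.locallyIntegrable_grad.congr hGH
  integral_eq φ hφ hφc hφU i j := by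
    rw [hu.integral_eq φ hφ hφc hφU i j]
    congr 1
    refine integral_congr_ae ?_
    filter_upwards [hGH] with x hx
    rw [hx]

theorem Mat.continuous_apply (A : Mat n) : Continuous (Mat.apply A) := by
  unfold Mat.apply
  fun_prop

theorem integral_coord_mul_fderiv {φ : Eucl n → ℝ} (hφ : ContDiff ℝ ∞ φ)
    (hφc : HasCompactSupport φ) (k j : Fin n) :
    ∫ x : Eucl n, x k * fderiv ℝ φ x (EuclideanSpace.single j 1) =
      - ∫ x, (if k = j then 1 else 0) * φ x := by
  have hc : ∀ v, Continuous fun x => fderiv ℝ φ x v := continuous_fderiv_apply_const hφ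
  have hd : ∀ x, fderiv ℝ (fun y : Eucl n => y k) x (EuclideanSpace.single j 1) =
      if k = j then 1 else 0 := by
    intro x
    have : HasFDerivAt (fun y : Eucl n => y k) (EuclideanSpace.proj (𝕜 := ℝ) k) x :=
      (EuclideanSpace.proj (𝕜 := ℝ) k).hasFDerivAt
    rw [this.fderiv]
    simp
  have hk : Continuous fun x : Eucl n => x k := by fun_prop
  rw [integral_mul_fderiv_eq_neg_fderiv_mul_of_integrable]
  · simp only [hd]
  · simp only [hd]
    exact (hφ.continuous.integrable_of_hasCompactSupport hφc).const_mul _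
  · exact (hk.mul (hc _)).integrable_of_hasCompactSupport (hφc.fderiv_apply ℝ _).mul_left
  · exact (hk.mul hφ.continuous).integrable_of_hasCompactSupport hφc.mul_left
  · exact fun x _ => (EuclideanSpace.proj (𝕜 := ℝ) k).differentiableAt
  · exact fun x _ => hφ.differentiable (by simp) x

theorem hasWeakGradient_mat_apply (A : Mat n) :
    HasWeakGradient U (Mat.apply A) (fun _ => A) where
  locallyIntegrable := A.continuous_apply.locallyIntegrable.locallyIntegrableOn U
  locallyIntegrable_grad := continuous_const.locallyIntegrable.locallyIntegrableOn U
  integral_eq φ hφ hφc hφU i j := by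
    rw [setIntegral_eq_integral_of_forall_compl_eq_zero,
      setIntegral_eq_integral_of_forall_compl_eq_zero]
    · simp only [Mat.apply, Finset.sum_mul]
      rw [integral_finsetSum]
      · simp only [mul_assoc]
        simp_rw [integral_const_mul, integral_coord_mul_fderiv hφ hφc,
          integral_const_mul]
        simp
      · intro k _
        have hk : Continuous fun x : Eucl n => A (i, k) * x k := by fun_prop
        exact (hk.mul (continuous_fderiv_apply_const hφ _)).integrable_of_hasCompactSupport
          (hφc.fderiv_apply ℝ _).mul_left
    · intro x hx
      simp [image_eq_zero_of_notMem_tsupport fun h => hx (hφU h)]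
    · intro x hx
      have : fderiv ℝ φ x (EuclideanSpace.single j 1) = 0 := image_eq_zero_of_notMem_tsupport
        (f := fun x => fderiv ℝ φ x (EuclideanSpace.single j 1))
        fun h => hx (hφU (tsupport_fderiv_apply_subset ℝ _ h))
      simp [this]

theorem fderiv_apply_eq_sum (φ : Eucl n → ℝ) (x v : Eucl n) :
    fderiv ℝ φ x v = ∑ j, v j * fderiv ℝ φ x (EuclideanSpace.single j 1) := by
  have hv : v = ∑ j, v j • (EuclideanSpace.single j (1 : ℝ) : Eucl n) := by
    ext k
    simp [Pi.single_apply]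
  conv_lhs => rw [hv]
  simp

/-- A map with constant weak gradient on a connected open set is affine. -/
theorem HasWeakGradient.isAffineOn (h : HasWeakGradient U u G) (hU : IsOpen U)
    (hUc : IsConnected U) {A : Mat n} (hG : ∀ᵐ x ∂(volume.restrict U), G x = A) :
    IsAffineOn U u := by
  have h0 : HasWeakGradient U (fun x => u x + Mat.apply (-A) x) (fun _ => 0) := by
    refine (h.add (hasWeakGradient_mat_apply (-A))).congr_grad ?_
    filter_upwards [hG] with x hx
    simp [hx]
  have hconst : ∀ i, ∃ c : ℝ, ∀ᵐ x ∂(volume.restrict U), (u x + Mat.apply (-A) x) i = c := by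
    intro i
    refine exists_ae_eq_const_of_forall_integral_fderiv_eq_zero hU hUc
      (h0.locallyIntegrable.euclidean_apply i) fun φ hφ hφc hφU v => ?_
    simp_rw [fderiv_apply_eq_sum φ _ v, Finset.mul_sum]
    rw [integral_finsetSum]
    · refine Finset.sum_eq_zero fun j _ => ?_
      simp_rw [mul_left_comm _ (v j)]
      rw [integral_const_mul, h0.integral_eq φ hφ hφc hφU i j]
      simp
    · intro j _
      simp_rw [mul_left_comm _ (v j)]
      exact ((h0.integrable_mul_fderiv hφ hφc hφU i _).const_mul _).integrableOn
  choose c hc using hconst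
  refine ⟨A, WithLp.toLp 2 c, ?_⟩
  filter_upwards [ae_all_iff.2 hc] with x hx
  ext i
  have := hx i
  simp only [Mat.apply, PiLp.add_apply, PiLp.neg_apply, neg_mul, Finset.sum_neg_distrib] at this ⊢
  linarith

end WeakGradient

/-! ### Rigidity for exact solutions -/

theorem MemW1.mono_exponent {n : ℕ} {U : Set (Eucl n)} {u : Eucl n → Eucl n}
    {G : Eucl n → Mat n} (h : MemW1 ∞ U u G) (hU : Bornology.IsBounded U) (p : ℝ≥0∞) :
    MemW1 p U u G := by
  have : IsFiniteMeasure (volume.restrict U) := ⟨by simpa using hU.measure_lt_top⟩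
  exact ⟨h.memLp.mono_exponent le_top, h.memLp_grad.mono_exponent le_top, h.weakGradient⟩

theorem QuantRigidityEstimate.rigidExact {n : ℕ} {U : Set (Eucl n)}
    (hU : IsBoundedLipschitzDomain U) {K : Set (Mat n)} {p : ℝ} (hp : 1 < p)
    (hrig : QuantRigidityEstimate (ENNReal.ofReal p) U K) : RigidExact U K := by
  intro u G hu hGK
  obtain ⟨C, hC, hest⟩ := hrig
  obtain ⟨A, hA, hle⟩ := hest u G (hu.mono_exponent hU.isBounded _)
  have hp0 : ENNReal.ofReal p ≠ 0 := by simpa using by linarith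
  have h0 : eLpNorm (fun x => Metric.infDist (G x) K) (ENNReal.ofReal p)
      (volume.restrict U) = 0 := by
    rw [eLpNorm_congr_ae (g := fun _ => (0 : ℝ))]
    · simp
    · filter_upwards [hGK] with x hx
      exact Metric.infDist_zero_of_mem hx
  rw [h0, mul_zero, nonpos_iff_eq_zero, eLpNorm_eq_zero_iff (f := fun x => G x - A)
    (hu.memLp_grad.aestronglyMeasurable.sub aestronglyMeasurable_const) hp0] at hle
  refine hu.weakGradient.isAffineOn hU.isOpen hU.isConnected (A := A) ?_
  filter_upwards [hle] with x hx
  simpa [sub_eq_zero] using hx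

/-! ### Uniform bounds and uniform integrability -/

section Bounded

variable {X : Type*} [MeasurableSpace X] {μ : Measure X}

/-- The uniform boundedness principle in `L^∞`, regarded as the dual of `L¹`. -/
theorem exists_ae_bound_of_forall_integral_mul_bounded [IsFiniteMeasure μ] {f : ℕ → X → ℝ}
    (hf : ∀ k, MemLp (f k) ∞ μ)
    (h : ∀ g : X → ℝ, Integrable g μ → ∃ C, ∀ k, |∫ x, g x * f k x ∂μ| ≤ C) :
    ∃ C : ℝ, ∀ k, ∀ᵐ x ∂μ, |f k x| ≤ C := by
  let T : ℕ → Lp ℝ 1 μ →L[ℝ] ℝ := fun k =>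
    (ContinuousLinearMap.mul ℝ ℝ).lpPairing μ ∞ 1 ((hf k).toLp (f k))
  have hT : ∀ k g, T k g = ∫ x, g x * f k x ∂μ := by
    intro k g
    rw [ContinuousLinearMap.lpPairing_eq_integral]
    refine integral_congr_ae ?_
    filter_upwards [(hf k).coeFn_toLp] with x hx
    simp [hx, mul_comm]
  obtain ⟨C, hC⟩ := banach_steinhaus (g := T) fun g => by
    obtain ⟨C, hC⟩ := h g (L1.integrable_coeFn g)
    exact ⟨C, fun k => by rw [hT]; exact hC k⟩
  refine ⟨C, fun k => ?_⟩
  have hfi : Integrable (f k) μ := (hf k).integrable le_top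
  -- Applying the functional to an indicator bounds the integral of `f k` over every set by `C`
  -- times its measure, which forces the pointwise bound a.e.
  have hset : ∀ s, MeasurableSet s → μ s < ⊤ → |∫ x in s, f k x ∂μ| ≤ C * μ.real s := by
    intro s hs hμs
    have h1 : T k (indicatorConstLp 1 hs hμs.ne (1 : ℝ)) = ∫ x in s, f k x ∂μ := by
      rw [hT, ← integral_indicator hs]
      refine integral_congr_ae ?_
      filter_upwards [indicatorConstLp_coeFn (p := 1) (hs := hs) (hμs := hμs.ne) (c := (1 : ℝ))]
        with x hx
      rw [hx]
      by_cases hxs : x ∈ s <;> simp [hxs]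
    rw [← h1, ← Real.norm_eq_abs]
    refine ((T k).le_opNorm _).trans ?_
    rw [norm_indicatorConstLp one_ne_zero ENNReal.one_ne_top]
    simp only [norm_one, one_mul, ENNReal.toReal_one, div_one, Real.rpow_one]
    exact mul_le_mul_of_nonneg_right (hC k) measureReal_nonneg
  have h1 : f k ≤ᵐ[μ] fun _ => C := by
    refine ae_le_of_forall_setIntegral_le hfi (integrable_const C) fun s hs hμs => ?_
    rw [setIntegral_const, smul_eq_mul, mul_comm]
    exact (le_abs_self _).trans (hset s hs hμs)
  have h2 : (fun _ => -C) ≤ᵐ[μ] f k := by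
    refine ae_le_of_forall_setIntegral_le (integrable_const _) hfi fun s hs hμs => ?_
    rw [setIntegral_const, smul_eq_mul, mul_comm]
    linarith [(abs_le.1 (hset s hs hμs)).1]
  filter_upwards [h1, h2] with x hx1 hx2
  exact abs_le.2 ⟨hx2, hx1⟩

theorem unifIntegrable_of_ae_bound {E : Type*} [NormedAddCommGroup E] {f : ℕ → X → E}
    {p : ℝ≥0∞} (hp : 1 ≤ p) (hp' : p ≠ ⊤) (hf : ∀ k, AEStronglyMeasurable (f k) μ) {C : ℝ}
    (h : ∀ k, ∀ᵐ x ∂μ, ‖f k x‖ ≤ C) : UnifIntegrable f p μ := by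
  -- The truncation set is defined by a non-strict inequality, so the level must exceed `C` for it
  -- to be null.
  refine unifIntegrable_of hp hp' hf fun ε _ => ⟨(C + 1).toNNReal, fun k => ?_⟩
  rw [eLpNorm_congr_ae (g := fun _ => (0 : E))]
  · simp
  · filter_upwards [h k] with x hx
    refine Set.indicator_of_notMem (fun hmem => ?_) _
    have h1 : (C + 1).toNNReal ≤ ‖f k x‖₊ := hmem
    have h2 := Real.toNNReal_le_iff_le_coe.1 h1
    rw [coe_nnnorm] at h2
    linarith

end Bounded

/-! ### Strong rigidity -/

section StronglyRigid

variable {n : ℕ} {U : Set (Eucl n)}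

theorem EuclideanSpace.norm_le_sqrt_sum {ι : Type*} [Fintype ι] {A : EuclideanSpace ℝ ι}
    {C : ι → ℝ} (h : ∀ i, |A i| ≤ C i) : ‖A‖ ≤ √(∑ i, C i ^ 2) := by
  rw [EuclideanSpace.norm_eq]
  refine Real.sqrt_le_sqrt (Finset.sum_le_sum fun i _ => ?_)
  rw [Real.norm_eq_abs]
  exact pow_le_pow_left₀ (abs_nonneg _) (h i) 2

variable {us : ℕ → Eucl n → Eucl n} {Gs : ℕ → Eucl n → Mat n} {u : Eucl n → Eucl n}
  {G : Eucl n → Mat n}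

theorem WeakStarTendstoW1.exists_grad_bound (h : WeakStarTendstoW1 U us Gs u G)
    (hU : Bornology.IsBounded U) :
    ∃ M : ℝ, ∀ k, ∀ᵐ x ∂(volume.restrict U), ‖Gs k x‖ ≤ M := by
  have : IsFiniteMeasure (volume.restrict U) := ⟨by simpa using hU.measure_lt_top⟩
  have key : ∀ q : Fin n × Fin n, ∃ C : ℝ, ∀ k, ∀ᵐ x ∂(volume.restrict U), |Gs k x q| ≤ C := by
    intro q
    refine exists_ae_bound_of_forall_integral_mul_bounded (f := fun k x => Gs k x q)
      (fun k => (EuclideanSpace.proj (𝕜 := ℝ) q).comp_memLp' (h.mem k).memLp_grad) fun g hg => ?_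
    obtain ⟨C, hC⟩ := (h.tendsto_grad g hg q.1 q.2).norm.bddAbove_range
    exact ⟨C, fun k => hC ⟨k, rfl⟩⟩
  choose C hC using key
  refine ⟨√(∑ q, C q ^ 2), fun k => ?_⟩
  filter_upwards [ae_all_iff.2 fun q => hC q k] with x hx
  exact EuclideanSpace.norm_le_sqrt_sum hx

/-- Indicators are integrable on the bounded set `U`, hence legitimate test functions for the weak*
convergence, entry by entry. -/
theorem WeakStarTendstoW1.tendsto_setIntegral_grad (h : WeakStarTendstoW1 U us Gs u G)
    (hU : Bornology.IsBounded U) {s : Set (Eucl n)} (hs : MeasurableSet s) :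
    Tendsto (fun k => ∫ x in s, Gs k x ∂(volume.restrict U)) atTop
      (𝓝 (∫ x in s, G x ∂(volume.restrict U))) := by
  have : IsFiniteMeasure (volume.restrict U) := ⟨by simpa using hU.measure_lt_top⟩
  have hcoord : ∀ {F : Eucl n → Mat n}, MemLp F ∞ (volume.restrict U) → ∀ q : Fin n × Fin n,
      ∫ x in U, s.indicator (fun _ => (1 : ℝ)) x * F x q =
        (∫ x in s, F x ∂(volume.restrict U)) q := by
    intro F hF q
    have hi : Integrable F (volume.restrict U) := hF.integrable le_top
    have := (EuclideanSpace.proj (𝕜 := ℝ) q).integral_comp_comm hi.integrableOn.integrable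
      (μ := (volume.restrict U).restrict s)
    simp only [PiLp.proj_apply] at this
    rw [← this, ← integral_indicator hs]
    congr 1
    ext x
    by_cases hx : x ∈ s <;> simp [hx]
  have hlim : Tendsto (fun k => (∫ x in s, Gs k x ∂(volume.restrict U)).ofLp) atTop
      (𝓝 (∫ x in s, G x ∂(volume.restrict U)).ofLp) := by
    refine tendsto_pi_nhds.2 fun q => ?_
    have hg : IntegrableOn (s.indicator fun _ => (1 : ℝ)) U volume :=
      (integrable_const (1 : ℝ)).indicator hs
    simpa only [hcoord h.mem_limit.memLp_grad, hcoord (h.mem _).memLp_grad] using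
      h.tendsto_grad _ hg q.1 q.2
  exact ((PiLp.continuous_toLp 2 _).tendsto _).comp hlim

theorem QuantRigidityEstimate.stronglyRigid (hU : IsBoundedLipschitzDomain U) {K : Set (Mat n)}
    (hK_ne : K.Nonempty) {p : ℝ} (hp : 1 < p)
    (hrig : QuantRigidityEstimate (ENNReal.ofReal p) U K) : StronglyRigid U K := by
  intro us Gs u G hw hd
  have hfin : IsFiniteMeasure (volume.restrict U) := ⟨by simpa using hU.isBounded.measure_lt_top⟩
  obtain ⟨C, hC, hest⟩ := hrig
  obtain ⟨M, hM⟩ := hw.exists_grad_bound hU.isBounded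
  obtain ⟨B, hB⟩ := hK_ne
  set ν := volume.restrict U with hν
  set P := ENNReal.ofReal p with hP
  have hP1 : 1 ≤ P := by rw [hP, ← ENNReal.ofReal_one]; exact ENNReal.ofReal_le_ofReal hp.le
  have hPt : P ≠ ⊤ := ENNReal.ofReal_ne_top
  have hP0 : P ≠ 0 := (zero_lt_one.trans_le hP1).ne'
  have hGm : ∀ k, AEStronglyMeasurable (Gs k) ν := fun k => (hw.mem k).memLp_grad.1
  have hGi : ∀ k, Integrable (Gs k) ν := fun k => (hw.mem k).memLp_grad.integrable le_top
  have hdm : ∀ k, AEStronglyMeasurable (fun x => Metric.infDist (Gs k x) K) ν := fun k =>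
    (Metric.continuous_infDist_pt K).comp_aestronglyMeasurable (hGm k)
  -- Vitali: the distances are uniformly bounded by `M + ‖B‖` with `B ∈ K`, so convergence in
  -- measure becomes convergence in `L^p`.
  have hdlim : Tendsto (fun k => eLpNorm (fun x => Metric.infDist (Gs k x) K) P ν) atTop (𝓝 0) := by
    have hui : UnifIntegrable (fun k x => Metric.infDist (Gs k x) K) P ν := by
      refine unifIntegrable_of_ae_bound hP1 hPt hdm (C := M + ‖B‖) fun k => ?_
      filter_upwards [hM k] with x hx
      rw [Real.norm_of_nonneg Metric.infDist_nonneg]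
      refine (Metric.infDist_le_dist_of_mem hB).trans ?_
      rw [dist_eq_norm]
      exact (norm_sub_le _ _).trans (by linarith)
    have := tendsto_Lp_finite_of_tendstoInMeasure hP1 hPt hdm (MemLp.zero' (p := P)) hui hd
    refine this.congr fun k => ?_
    congr 1
    ext x
    simp
  choose A hAK hA using fun k => hest (us k) (Gs k) ((hw.mem k).mono_exponent hU.isBounded P)
  have hsub : Tendsto (fun k => eLpNorm (fun x => Gs k x - A k) P ν) atTop (𝓝 0) := by
    refine tendsto_of_tendsto_of_tendsto_of_le_of_le tendsto_const_nhds ?_ (fun _ => zero_le) hA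
    simpa using ENNReal.Tendsto.const_mul hdlim (Or.inr (ENNReal.ofReal_ne_top (r := C)))
  have toL1 : ∀ F : ℕ → Eucl n → Mat n, (∀ k, AEStronglyMeasurable (F k) ν) →
      Tendsto (fun k => eLpNorm (F k) P ν) atTop (𝓝 0) →
      Tendsto (fun k => eLpNorm (F k) 1 ν) atTop (𝓝 0) := by
    intro F hF hlim
    refine tendsto_of_tendsto_of_tendsto_of_le_of_le tendsto_const_nhds ?_ (fun _ => zero_le)
      fun k => eLpNorm_le_eLpNorm_mul_rpow_measure_univ hP1 (hF k)
    have hexp : 0 ≤ 1 / (1 : ℝ≥0∞).toReal - 1 / P.toReal := by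
      rw [hP, ENNReal.toReal_ofReal (by linarith)]
      simp only [ENNReal.toReal_one, div_one, sub_nonneg]
      rw [div_le_one (by linarith)]
      exact hp.le
    have hne : ν Set.univ ^ (1 / (1 : ℝ≥0∞).toReal - 1 / P.toReal) ≠ ⊤ :=
      ENNReal.rpow_ne_top_of_nonneg hexp (measure_ne_top _ _)
    simpa using ENNReal.Tendsto.mul_const hlim (Or.inr hne)
  have hint : Tendsto (fun k => ∫ x, (Gs k x - A k) ∂ν) atTop (𝓝 0) := by
    have h1 := toL1 (fun k x => Gs k x - A k) (fun k => (hGm k).sub aestronglyMeasurable_const) hsub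
    have := tendsto_integral_of_L1' (μ := ν) (fun _ : Eucl n => (0 : Mat n))
      aestronglyMeasurable_const (F := fun k x => Gs k x - A k) (l := atTop)
      (Eventually.of_forall fun k => (hGi k).sub (integrable_const _))
      (h1.congr fun k => by congr 1; ext x : 1; simp)
    simpa using this
  have hν0 : ν.real Set.univ ≠ 0 := by
    have := hU.isOpen.measure_pos volume hU.isConnected.nonempty
    rw [measureReal_def, Measure.restrict_apply_univ]
    exact (ENNReal.toReal_pos this.ne' hU.isBounded.measure_lt_top.ne).ne'
  -- The limit of the `A k` has to be the mean of `G`: the mean of `Gs k - A k` tends to zero, and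
  -- the mean of `Gs k` tends to that of `G`.
  set A' : Mat n := (ν.real Set.univ)⁻¹ • ∫ x, G x ∂ν
  have hAlim : Tendsto A atTop (𝓝 A') := by
    have htot := hw.tendsto_setIntegral_grad hU.isBounded MeasurableSet.univ
    simp only [Measure.restrict_univ] at htot
    have h1 := (htot.sub hint).const_smul (ν.real Set.univ)⁻¹
    rw [sub_zero] at h1
    refine h1.congr fun k => ?_
    rw [integral_sub (hGi k) (integrable_const _), sub_sub_cancel, integral_const,
      inv_smul_smul₀ hν0]
  have hGA : Tendsto (fun k => eLpNorm (fun x => Gs k x - A') P ν) atTop (𝓝 0) := by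
    have hle : ∀ k, eLpNorm (fun x => Gs k x - A') P ν ≤
        eLpNorm (fun x => Gs k x - A k) P ν + eLpNorm (fun _ => A k - A') P ν := by
      intro k
      refine le_trans (le_of_eq ?_) (eLpNorm_add_le ((hGm k).sub aestronglyMeasurable_const)
        aestronglyMeasurable_const hP1)
      congr 1
      ext x : 1
      simp
    refine tendsto_of_tendsto_of_tendsto_of_le_of_le tendsto_const_nhds ?_ (fun _ => zero_le) hle
    have hc : Tendsto (fun k => eLpNorm (fun _ : Eucl n => A k - A') P ν) atTop (𝓝 0) := by
      simp_rw [eLpNorm_const' _ hP0 hPt]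
      have h1 : Tendsto (fun k => ‖A k - A'‖ₑ) atTop (𝓝 0) := by
        simpa using (hAlim.sub_const A').enorm
      have hne : ν Set.univ ^ (1 / P.toReal) ≠ ⊤ :=
        ENNReal.rpow_ne_top_of_nonneg (by positivity) (measure_ne_top _ _)
      simpa using ENNReal.Tendsto.mul_const h1 (Or.inr hne)
    simpa using hsub.add hc
  have hGA1 := toL1 _ (fun k => (hGm k).sub aestronglyMeasurable_const) hGA
  have hGi' : Integrable G ν := hw.mem_limit.memLp_grad.integrable le_top
  -- The integrals of `Gs k` over each set converge to those of `G` weakly* and to those of `A'` by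
  -- `L¹` convergence.
  have hGeq : G =ᵐ[ν] fun _ => A' := by
    refine hGi'.ae_eq_of_forall_setIntegral_eq _ _ (integrable_const _) fun s hs _ => ?_
    refine tendsto_nhds_unique (hw.tendsto_setIntegral_grad hU.isBounded hs) ?_
    exact tendsto_setIntegral_of_L1' (fun _ => A') aestronglyMeasurable_const
      (Eventually.of_forall hGi) hGA1 s
  refine ⟨?_, hw.mem_limit.weakGradient.isAffineOn hU.isOpen hU.isConnected hGeq⟩
  exact (tendstoInMeasure_of_tendsto_eLpNorm hP0 hGm aestronglyMeasurable_const hGA).congr_right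
    hGeq.symm

theorem StronglyRigid.rigidApprox {K : Set (Mat n)} (h : StronglyRigid U K) : RigidApprox U K :=
  fun us Gs u G hw hd _ => h us Gs u G hw hd

end StronglyRigid

/-! ### Test maps in `W^{1,∞}_0`: sums, supports, rescaling -/

section W1Infty

variable {n : ℕ} {D : Set (Eucl n)} {u v φ : Eucl n → Eucl n} {G H : Eucl n → Mat n}

theorem MemW1.ae_norm_grad_le (h : MemW1 ∞ Set.univ u G) : ∃ M : ℝ, ∀ᵐ x, ‖G x‖ ≤ M := by
  refine ⟨(eLpNorm G ∞ volume).toReal, ?_⟩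
  have hG := h.memLp_grad
  rw [Measure.restrict_univ] at hG
  filter_upwards [ae_le_eLpNormEssSup (f := G) (μ := volume)] with x hx
  rw [← eLpNorm_exponent_top] at hx
  have := ENNReal.toReal_mono hG.2.ne hx
  simpa using this

theorem MemW1.aestronglyMeasurable_grad (h : MemW1 ∞ Set.univ u G) :
    AEStronglyMeasurable G volume := by
  simpa using h.memLp_grad.1

theorem MemW1.add (hu : MemW1 ∞ D u G) (hv : MemW1 ∞ D v H) :
    MemW1 ∞ D (fun x => u x + v x) (fun x => G x + H x) :=
  ⟨hu.memLp.add hv.memLp, hu.memLp_grad.add hv.memLp_grad, hu.weakGradient.add hv.weakGradient⟩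

theorem memW1InftyZero_zero : MemW1InftyZero D (fun _ => 0) (fun _ => 0) := by
  refine ⟨⟨MemLp.zero', MemLp.zero', ?_⟩, by simp⟩
  exact ⟨locallyIntegrableOn_zero, locallyIntegrableOn_zero, by simp⟩

theorem MemW1InftyZero.add (hu : MemW1InftyZero D u G) (hv : MemW1InftyZero D v H) :
    MemW1InftyZero D (fun x => u x + v x) (fun x => G x + H x) := by
  refine ⟨hu.1.add hv.1, ?_⟩
  filter_upwards [hu.2, hv.2] with x h1 h2 hx
  simp [h1 hx, h2 hx]

theorem MemW1InftyZero.sum {ι : Type*} {u : ι → Eucl n → Eucl n} {G : ι → Eucl n → Mat n}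
    (s : Finset ι) (h : ∀ i ∈ s, MemW1InftyZero D (u i) (G i)) :
    MemW1InftyZero D (fun x => ∑ i ∈ s, u i x) (fun x => ∑ i ∈ s, G i x) := by
  classical
  induction s using Finset.induction_on with
  | empty => simpa using memW1InftyZero_zero
  | insert a s ha ih =>
    simp only [Finset.sum_insert ha]
    exact (h a (Finset.mem_insert_self a s)).add
      (ih fun i hi => h i (Finset.mem_insert_of_mem hi))

theorem MemW1InftyZero.mono {D' : Set (Eucl n)} (h : MemW1InftyZero D u G) (hD : D ⊆ D') :
    MemW1InftyZero D' u G :=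
  ⟨h.1, h.2.mono fun _ hx hxD => hx fun hD' => hxD (hD hD')⟩

/-- The weak gradient vanishes almost everywhere off a closed set off which the map vanishes. -/
theorem MemW1InftyZero.grad_ae_eq_zero (h : MemW1InftyZero D u G) {C : Set (Eucl n)}
    (hC : IsClosed C) (hDC : D ⊆ C) : ∀ᵐ x, x ∉ C → G x = 0 := by
  have hG : LocallyIntegrableOn G Cᶜ volume :=
    h.1.weakGradient.locallyIntegrable_grad.mono_set (Set.subset_univ _)
  have key : ∀ q : Fin n × Fin n, ∀ᵐ x, x ∈ Cᶜ → G x q = 0 := by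
    rintro ⟨i, j⟩
    refine hC.isOpen_compl.ae_eq_zero_of_integral_contDiff_smul_eq_zero
      (hG.euclidean_apply (i, j)) fun φ hφ hφc hφU => ?_
    have h1 := h.1.weakGradient.integral_eq φ hφ hφc (Set.subset_univ _) i j
    rw [Measure.restrict_univ] at h1
    have h0 : ∫ x, u x i * fderiv ℝ φ x (EuclideanSpace.single j 1) = 0 := by
      rw [← integral_zero (Eucl n) ℝ (μ := volume)]
      refine integral_congr_ae ?_
      filter_upwards [h.2] with x hx
      by_cases hxD : x ∈ D
      · have : fderiv ℝ φ x (EuclideanSpace.single j 1) = 0 := image_eq_zero_of_notMem_tsupport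
          (f := fun x => fderiv ℝ φ x (EuclideanSpace.single j 1))
          fun hm => hφU (tsupport_fderiv_apply_subset ℝ _ hm) (hDC hxD)
        simp [this]
      · simp [hx hxD]
    simp only [smul_eq_mul, mul_comm (φ _)]
    linarith
  filter_upwards [ae_all_iff.2 key] with x hx hxC
  ext q
  exact hx q hxC

/-- The weak gradient of a compactly supported map has mean zero. -/
theorem MemW1InftyZero.integral_grad_eq_zero (h : MemW1InftyZero D u G)
    (hD : Bornology.IsBounded D) (hG : ∀ᵐ x, x ∉ D → G x = 0) : ∫ x in D, G x = 0 := by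
  obtain ⟨R, hR, hDR⟩ := hD.subset_ball_lt 0 0
  -- A cutoff equal to 1 near `D` replaces the constant test function: its derivative vanishes on
  -- `D`, and `u` vanishes off `D`.
  let χ : ContDiffBump (0 : Eucl n) := ⟨R, R + 1, hR, by linarith⟩
  have hχ1 : ∀ x ∈ D, χ x = 1 := fun x hx =>
    χ.one_of_mem_closedBall (Metric.ball_subset_closedBall (hDR hx))
  have hχ' : ∀ x ∈ D, fderiv ℝ χ x = 0 := by
    intro x hx
    have : χ =ᶠ[𝓝 x] fun _ => (1 : ℝ) := by
      filter_upwards [Metric.isOpen_ball.mem_nhds (hDR hx)] with y hy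
      exact χ.one_of_mem_closedBall (Metric.ball_subset_closedBall hy)
    rw [this.fderiv_eq]
    simp
  have hGm := h.1.aestronglyMeasurable_grad
  obtain ⟨M, hM⟩ := h.1.ae_norm_grad_le
  have hint : IntegrableOn G D volume :=
    Measure.integrableOn_of_bounded hD.measure_lt_top.ne hGm (ae_restrict_of_ae hM)
  have hint' : Integrable G volume :=
    hint.integrable_of_ae_notMem_eq_zero hG
  rw [setIntegral_eq_integral_of_ae_compl_eq_zero hG]
  ext ⟨i, j⟩
  have hcomm := (EuclideanSpace.proj (𝕜 := ℝ) (i, j)).integral_comp_comm hint'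
  simp only [PiLp.proj_apply] at hcomm
  rw [← hcomm, PiLp.zero_apply]
  have h1 := h.1.weakGradient.integral_eq χ (χ.contDiff (n := ⊤)) χ.hasCompactSupport
    (Set.subset_univ _) i j
  rw [Measure.restrict_univ] at h1
  have h2 : ∫ x, u x i * fderiv ℝ χ x (EuclideanSpace.single j 1) = 0 := by
    rw [← integral_zero (Eucl n) ℝ (μ := volume)]
    refine integral_congr_ae ?_
    filter_upwards [h.2] with x hx
    by_cases hxD : x ∈ D
    · simp [hχ' x hxD]
    · simp [hx hxD]
  have h3 : ∫ x, G x (i, j) * χ x = ∫ x, G x (i, j) := by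
    refine integral_congr_ae ?_
    filter_upwards [hG] with x hx
    by_cases hxD : x ∈ D
    · simp [hχ1 x hxD]
    · simp [hx hxD]
  rw [← h3]
  linarith

theorem MemW1.restrict (h : MemW1 ∞ Set.univ u G) : MemW1 ∞ D u G where
  memLp := h.memLp.mono_measure (Measure.restrict_mono_set _ (Set.subset_univ _))
  memLp_grad := h.memLp_grad.mono_measure (Measure.restrict_mono_set _ (Set.subset_univ _))
  weakGradient :=
  { locallyIntegrable := h.weakGradient.locallyIntegrable.mono_set (Set.subset_univ _)
    locallyIntegrable_grad := h.weakGradient.locallyIntegrable_grad.mono_set (Set.subset_univ _)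
    integral_eq := fun φ hφ hφc hφU i j => by
      have h1 := h.weakGradient.integral_eq φ hφ hφc (Set.subset_univ _) i j
      rw [Measure.restrict_univ] at h1
      rw [setIntegral_eq_integral_of_forall_compl_eq_zero,
        setIntegral_eq_integral_of_forall_compl_eq_zero, h1]
      · intro x hx
        simp [image_eq_zero_of_notMem_tsupport fun h => hx (hφU h)]
      · intro x hx
        have : fderiv ℝ φ x (EuclideanSpace.single j 1) = 0 := image_eq_zero_of_notMem_tsupport
          (f := fun x => fderiv ℝ φ x (EuclideanSpace.single j 1))
          fun h => hx (hφU (tsupport_fderiv_apply_subset ℝ _ h))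
        simp [this] }

theorem quasiMeasurePreserving_inv_smul_sub {r : ℝ} (hr : 0 < r) (x : Eucl n) :
    Measure.QuasiMeasurePreserving (fun y : Eucl n => r⁻¹ • (y - x)) volume volume :=
  (Measure.quasiMeasurePreserving_smul volume (inv_ne_zero hr.ne')).comp
    (measurePreserving_sub_right volume x).quasiMeasurePreserving

theorem integral_comp_inv_smul_sub {r : ℝ} (hr : 0 < r) (x : Eucl n) (f : Eucl n → ℝ) :
    ∫ y, f (r⁻¹ • (y - x)) = r ^ n * ∫ z, f z := by
  rw [integral_sub_right_eq_self (fun y => f (r⁻¹ • y)) x,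
    Measure.integral_comp_inv_smul_of_nonneg _ _ hr.le]
  simp

theorem memLp_top_comp_inv_smul_sub {E : Type*} [NormedAddCommGroup E] {f : Eucl n → E}
    (hf : MemLp f ∞ volume) {r : ℝ} (hr : 0 < r) (x : Eucl n) :
    MemLp (fun y => f (r⁻¹ • (y - x))) ∞ volume := by
  have hq := quasiMeasurePreserving_inv_smul_sub hr x
  refine memLp_top_of_bound (hf.1.comp_quasiMeasurePreserving hq) (eLpNorm f ∞ volume).toReal ?_
  refine hq.ae (p := fun z => ‖f z‖ ≤ (eLpNorm f ∞ volume).toReal) ?_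
  filter_upwards [ae_le_eLpNormEssSup (f := f) (μ := volume)] with x hx
  rw [← eLpNorm_exponent_top] at hx
  simpa using ENNReal.toReal_mono hf.2.ne hx

/-- The outer factor `r` cancels the `r⁻¹` of the chain rule, so the gradient takes the same values
at every scale. The weak identity comes from testing that of `u` with `z ↦ φ (x + r • z)`. -/
theorem MemW1.comp_inv_smul_sub (h : MemW1 ∞ Set.univ u G) {r : ℝ} (hr : 0 < r) (x : Eucl n) :
    MemW1 ∞ Set.univ (fun y => r • u (r⁻¹ • (y - x))) (fun y => G (r⁻¹ • (y - x))) := by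
  have hu := h.memLp
  have hG := h.memLp_grad
  rw [Measure.restrict_univ] at hu hG
  have hu' := (memLp_top_comp_inv_smul_sub hu hr x).const_smul r
  have hG' := memLp_top_comp_inv_smul_sub hG hr x
  refine ⟨by rw [Measure.restrict_univ]; exact hu', by rw [Measure.restrict_univ]; exact hG', ?_⟩
  refine ⟨(hu'.locallyIntegrable le_top).locallyIntegrableOn _,
    (hG'.locallyIntegrable le_top).locallyIntegrableOn _, fun φ hφ hφc _ i j => ?_⟩
  rw [Measure.restrict_univ]
  have hinv : ∀ y : Eucl n, x + r • r⁻¹ • (y - x) = y := fun y => by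
    rw [smul_inv_smul₀ hr.ne']
    abel
  let θ : Eucl n ≃ₜ Eucl n := (Homeomorph.smulOfNeZero r hr.ne').trans (Homeomorph.addLeft x)
  have hθ : ∀ z, θ z = x + r • z := fun z => rfl
  have hψ : ContDiff ℝ ∞ (fun z => φ (x + r • z)) :=
    hφ.comp (contDiff_const.add (contDiff_id.const_smul r))
  have hψc : HasCompactSupport (fun z => φ (x + r • z)) := hφc.comp_homeomorph θ
  have hψ' : ∀ z w, fderiv ℝ (fun z => φ (x + r • z)) z w = r * fderiv ℝ φ (x + r • z) w := by
    intro z w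
    have h1 : HasFDerivAt φ (fderiv ℝ φ (x + r • z)) (x + r • z) :=
      (hφ.differentiable (by simp) _).hasFDerivAt
    have h2 : HasFDerivAt (fun z : Eucl n => x + r • z) (r • ContinuousLinearMap.id ℝ (Eucl n)) z :=
      ((hasFDerivAt_id z).const_smul r).const_add x
    have h3 : HasFDerivAt (fun z => φ (x + r • z)) _ z := h1.comp z h2
    rw [h3.fderiv]
    simp
  have h1 := h.weakGradient.integral_eq _ hψ hψc (Set.subset_univ _) i j
  rw [Measure.restrict_univ] at h1
  simp only [hψ'] at h1
  have e1 := integral_comp_inv_smul_sub hr x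
    (fun z => u z i * (r * fderiv ℝ φ (x + r • z) (EuclideanSpace.single j 1)))
  have e2 := integral_comp_inv_smul_sub hr x (fun z => G z (i, j) * φ (x + r • z))
  simp only [hinv] at e1 e2
  rw [e2, ← mul_neg, ← h1, ← e1]
  congr 1
  ext y
  simp only [PiLp.smul_apply, smul_eq_mul]
  ring

theorem MemW1InftyZero.comp_inv_smul_sub (h : MemW1InftyZero (Metric.ball 0 1) u G) {r : ℝ}
    (hr : 0 < r) (x : Eucl n) :
    MemW1InftyZero (Metric.ball x r) (fun y => r • u (r⁻¹ • (y - x)))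
      (fun y => G (r⁻¹ • (y - x))) := by
  refine ⟨h.1.comp_inv_smul_sub hr x, ?_⟩
  filter_upwards [(quasiMeasurePreserving_inv_smul_sub hr x).ae h.2] with y hy hyr
  rw [hy, smul_zero]
  simp only [Metric.mem_ball, not_lt, dist_eq_norm, sub_zero] at hyr ⊢
  rw [norm_smul, norm_inv, Real.norm_of_nonneg hr.le, ← div_eq_inv_mul]
  exact (one_le_div hr).2 hyr

end W1Infty

/-! ### The quasiconvex envelope and its localisation at Lebesgue points -/

section Envelope

variable {n : ℕ} {F : Mat n → ℝ}

/-- `F` is Lipschitz on bounded sets. -/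
def LipschitzOnBounded (F : Mat n → ℝ) : Prop :=
  ∀ R : ℝ, ∃ L : ℝ, 0 ≤ L ∧ ∀ X Y : Mat n, ‖X‖ ≤ R → ‖Y‖ ≤ R → |F X - F Y| ≤ L * ‖X - Y‖

theorem LipschitzOnBounded.exists_bound (hF : LipschitzOnBounded F) (R : ℝ) :
    ∃ M : ℝ, 0 ≤ M ∧ ∀ X : Mat n, ‖X‖ ≤ R → |F X| ≤ M := by
  -- The maximum keeps the zero matrix, used as reference point, within the radius even when `R <
  -- 0`.
  obtain ⟨L, hL, h⟩ := hF (max R 0)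
  refine ⟨|F 0| + L * max R 0, by positivity, fun X hX => ?_⟩
  have h1 := h X 0 (hX.trans (le_max_left _ _)) (by simp)
  rw [sub_zero] at h1
  have h2 : L * ‖X‖ ≤ L * max R 0 := by gcongr; exact hX.trans (le_max_left _ _)
  have h3 := abs_sub_abs_le_abs_sub (F X) (F 0)
  linarith

theorem LipschitzOnBounded.continuous (hF : LipschitzOnBounded F) : Continuous F := by
  rw [continuous_iff_continuousAt]
  intro X
  obtain ⟨L, hL, h⟩ := hF (‖X‖ + 1)
  rw [ContinuousAt, tendsto_iff_norm_sub_tendsto_zero]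
  have hlim : Tendsto (fun Y : Mat n => L * ‖Y - X‖) (𝓝 X) (𝓝 0) := by
    have : Continuous fun Y : Mat n => L * ‖Y - X‖ := by fun_prop
    simpa using this.tendsto X
  refine squeeze_zero' (Eventually.of_forall fun _ => norm_nonneg _) ?_ hlim
  filter_upwards [Metric.ball_mem_nhds X one_pos] with Y hY
  refine h Y X ?_ (by linarith)
  rw [Metric.mem_ball, dist_eq_norm] at hY
  have := norm_sub_norm_le Y X
  linarith

theorem LipschitzOnBounded.integrableOn (hF : LipschitzOnBounded F) {W : Eucl n → Mat n}
    {D : Set (Eucl n)} (hD : volume D ≠ ⊤) (hW : AEStronglyMeasurable W volume) {R : ℝ}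
    (hR : ∀ᵐ x, ‖W x‖ ≤ R) : IntegrableOn (fun x => F (W x)) D volume := by
  obtain ⟨M, -, hM⟩ := hF.exists_bound R
  exact Measure.integrableOn_of_bounded hD (hF.continuous.comp_aestronglyMeasurable hW)
    (ae_restrict_of_ae (hR.mono fun x hx => hM _ hx))

/-- The quasiconvex envelope of `F` (up to the factor `|B|`): the infimum of
`∫_B F (X + ∇ψ)` over `ψ ∈ W^{1,∞}_0(B, ℝⁿ)`, where `B` is the unit ball. -/
noncomputable def qcEnvelope (F : Mat n → ℝ) (X : Mat n) : ℝ :=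
  ⨅ w : {w : (Eucl n → Eucl n) × (Eucl n → Mat n) //
      MemW1InftyZero (Metric.ball 0 1) w.1 w.2},
    ∫ x in Metric.ball (0 : Eucl n) 1, F (X + w.1.2 x)

theorem bddBelow_range_qcEnvelope (hF0 : ∀ X, 0 ≤ F X) (X : Mat n) :
    BddBelow (Set.range fun w : {w : (Eucl n → Eucl n) × (Eucl n → Mat n) //
      MemW1InftyZero (Metric.ball 0 1) w.1 w.2} =>
        ∫ x in Metric.ball (0 : Eucl n) 1, F (X + w.1.2 x)) :=
  ⟨0, by rintro _ ⟨w, rfl⟩; exact integral_nonneg fun x => hF0 _⟩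

theorem qcEnvelope_nonneg (hF0 : ∀ X, 0 ≤ F X) (X : Mat n) : 0 ≤ qcEnvelope F X :=
  Real.iInf_nonneg fun _ => integral_nonneg fun _ => hF0 _

theorem qcEnvelope_le (hF0 : ∀ X, 0 ≤ F X) (X : Mat n) {ψ : Eucl n → Eucl n}
    {H : Eucl n → Mat n} (h : MemW1InftyZero (Metric.ball 0 1) ψ H) :
    qcEnvelope F X ≤ ∫ x in Metric.ball (0 : Eucl n) 1, F (X + H x) :=
  ciInf_le (bddBelow_range_qcEnvelope hF0 X) ⟨(ψ, H), h⟩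

theorem qcEnvelope_le_const (hF0 : ∀ X, 0 ≤ F X) (X : Mat n) :
    qcEnvelope F X ≤ volume.real (Metric.ball (0 : Eucl n) 1) * F X := by
  have := qcEnvelope_le hF0 X (memW1InftyZero_zero (D := Metric.ball 0 1))
  simpa using this

theorem exists_integral_lt_qcEnvelope_add (X : Mat n) {δ : ℝ} (hδ : 0 < δ) :
    ∃ (ψ : Eucl n → Eucl n) (H : Eucl n → Mat n), MemW1InftyZero (Metric.ball 0 1) ψ H ∧
      ∫ x in Metric.ball (0 : Eucl n) 1, F (X + H x) < qcEnvelope F X + δ := by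
  have : Nonempty {w : (Eucl n → Eucl n) × (Eucl n → Mat n) //
      MemW1InftyZero (Metric.ball 0 1) w.1 w.2} := ⟨⟨(_, _), memW1InftyZero_zero⟩⟩
  obtain ⟨⟨⟨ψ, H⟩, h⟩, hlt⟩ := exists_lt_of_ciInf_lt
    (show qcEnvelope F X < qcEnvelope F X + δ by linarith)
  exact ⟨ψ, H, h, hlt⟩

/-- For a fixed test gradient, which is bounded, the energy is continuous in `X` by dominated
convergence; an infimum of continuous functions is upper semicontinuous. -/
theorem measurable_qcEnvelope (hF0 : ∀ X, 0 ≤ F X) (hF : LipschitzOnBounded F) :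
    Measurable (qcEnvelope F) := by
  refine UpperSemicontinuous.measurable ?_
  refine upperSemicontinuous_ciInf (bddBelow_range_qcEnvelope hF0) fun w => ?_
  obtain ⟨⟨ψ, H⟩, hw⟩ := w
  refine Continuous.upperSemicontinuous ?_
  rw [continuous_iff_continuousAt]
  intro X
  obtain ⟨M, hM⟩ := hw.1.ae_norm_grad_le
  obtain ⟨N, -, hN⟩ := hF.exists_bound (‖X‖ + 1 + M)
  have hfin : IsFiniteMeasure (volume.restrict (Metric.ball (0 : Eucl n) 1)) :=
    ⟨by simpa using measure_ball_lt_top⟩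
  refine continuousAt_of_dominated (bound := fun _ => N) ?_ ?_ (integrable_const _) ?_
  · refine Eventually.of_forall fun Y => ?_
    exact (hF.continuous.comp_aestronglyMeasurable
      (aestronglyMeasurable_const.add hw.1.aestronglyMeasurable_grad)).restrict
  · filter_upwards [Metric.ball_mem_nhds X one_pos] with Y hY
    filter_upwards [ae_restrict_of_ae hM] with x hx
    refine hN _ ((norm_add_le _ _).trans ?_)
    rw [Metric.mem_ball, dist_eq_norm] at hY
    have := norm_sub_norm_le Y X
    exact add_le_add (by linarith) hx
  · refine Eventually.of_forall fun x => ?_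
    exact (hF.continuous.comp (continuous_id.add continuous_const)).continuousAt

/-- The covering uses closed balls, the test maps the open unit ball; the unit sphere is null, so
the change of variables can mix them. -/
theorem setIntegral_closedBall_comp_inv_smul_sub {r : ℝ} (hr : 0 < r) (x : Eucl n)
    (f : Eucl n → ℝ) :
    ∫ y in Metric.closedBall x r, f (r⁻¹ • (y - x)) =
      r ^ n * ∫ z in Metric.ball (0 : Eucl n) 1, f z := by
  have h1 : (Metric.ball (0 : Eucl n) 1 : Set (Eucl n)) =ᵐ[volume] Metric.closedBall 0 1 :=
    ae_eq_of_subset_of_measure_ge Metric.ball_subset_closedBall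
      (Measure.addHaar_unitClosedBall_eq_addHaar_unitBall _).le
      measurableSet_ball.nullMeasurableSet measure_closedBall_lt_top.ne
  rw [setIntegral_congr_set h1, ← integral_indicator measurableSet_closedBall,
    ← integral_indicator measurableSet_closedBall,
    ← integral_comp_inv_smul_sub hr x]
  congr 1
  ext y
  have hiff : r⁻¹ • (y - x) ∈ Metric.closedBall (0 : Eucl n) 1 ↔ y ∈ Metric.closedBall x r := by
    rw [Metric.mem_closedBall, Metric.mem_closedBall, dist_eq_norm, dist_eq_norm, sub_zero,
      norm_smul, norm_inv, Real.norm_of_nonneg hr.le, ← div_eq_inv_mul, div_le_one hr]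
  by_cases hy : y ∈ Metric.closedBall x r
  · rw [Set.indicator_of_mem hy, Set.indicator_of_mem (hiff.2 hy)]
  · rw [Set.indicator_of_notMem hy, Set.indicator_of_notMem (mt hiff.1 hy)]

theorem volume_real_closedBall {r : ℝ} (hr : 0 < r) (x : Eucl n) :
    volume.real (Metric.closedBall x r) = r ^ n * volume.real (Metric.ball (0 : Eucl n) 1) := by
  simpa using Measure.addHaar_real_closedBall (volume : Measure (Eucl n)) x hr.le

/-- Near a Lebesgue point `x` of `W` and of `g`, rescaling a test gradient `H` that is nearly
optimal at `x` to a small ball around `x` brings the energy close to the mean of `g`. -/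
theorem eventually_setIntegral_closedBall_le (hF : LipschitzOnBounded F) {W H : Eucl n → Mat n}
    {g : Eucl n → ℝ} {M M' : ℝ} (hW : AEStronglyMeasurable W volume) (hWM : ∀ᵐ y, ‖W y‖ ≤ M)
    (hH : AEStronglyMeasurable H volume) (hHM : ∀ᵐ y, ‖H y‖ ≤ M')
    (hg : LocallyIntegrable g volume) {x : Eucl n} (hx : ‖W x‖ ≤ M)
    (hWx : Tendsto (fun r => ⨍ y in Metric.closedBall x r, ‖W y - W x‖) (𝓝[>] 0) (𝓝 0))
    (hgx : Tendsto (fun r => ⨍ y in Metric.closedBall x r, ‖g y - g x‖) (𝓝[>] 0) (𝓝 0))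
    {ε : ℝ} (hε : 0 < ε)
    (hopt : ∫ z in Metric.ball (0 : Eucl n) 1, F (W x + H z) ≤
      g x + volume.real (Metric.ball (0 : Eucl n) 1) * ε / 3) :
    ∀ᶠ r in 𝓝[>] (0 : ℝ), ∫ y in Metric.closedBall x r, F (W y + H (r⁻¹ • (y - x))) ≤
      (volume.real (Metric.ball (0 : Eucl n) 1))⁻¹ * (∫ y in Metric.closedBall x r, g y) +
        ε * volume.real (Metric.closedBall x r) := by
  set β := volume.real (Metric.ball (0 : Eucl n) 1) with hβ
  have hβ0 : 0 < β := ENNReal.toReal_pos (Metric.measure_ball_pos volume _ one_pos).ne'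
    measure_ball_lt_top.ne
  obtain ⟨L, hL, hLip⟩ := hF (M + M')
  have hWx' : Tendsto (fun r => L * ⨍ y in Metric.closedBall x r, ‖W y - W x‖) (𝓝[>] 0) (𝓝 0) := by
    simpa using hWx.const_mul L
  -- Three errors of `ε / 3` per unit volume: freezing `W` at `x`, replacing `g x` by its mean
  -- (where `β` cancels `β⁻¹`), and the slack in `hopt`.
  filter_upwards [hWx'.eventually (gt_mem_nhds (show 0 < ε / 3 by positivity)),
    hgx.eventually (gt_mem_nhds (show 0 < β * ε / 3 by positivity)),
    self_mem_nhdsWithin] with r h1 h2 hr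
  replace hr : 0 < r := hr
  set B := Metric.closedBall x r
  have hB : volume B ≠ ⊤ := measure_closedBall_lt_top.ne
  have hvol : volume.real B = r ^ n * β := volume_real_closedBall hr x
  have hvol0 : 0 < volume.real B := by rw [hvol]; positivity
  have hq := quasiMeasurePreserving_inv_smul_sub hr x
  have hHm : AEStronglyMeasurable (fun y => H (r⁻¹ • (y - x))) volume :=
    hH.comp_quasiMeasurePreserving hq
  have hHb : ∀ᵐ y, ‖H (r⁻¹ • (y - x))‖ ≤ M' := hq.ae hHM
  have hb1 : ∀ᵐ y, ‖W y + H (r⁻¹ • (y - x))‖ ≤ M + M' := by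
    filter_upwards [hHb, hWM] with y hy1 hy2 using (norm_add_le _ _).trans (add_le_add hy2 hy1)
  have hb2 : ∀ᵐ y, ‖W x + H (r⁻¹ • (y - x))‖ ≤ M + M' := by
    filter_upwards [hHb] with y hy1 using (norm_add_le _ _).trans (add_le_add hx hy1)
  have hi1 : IntegrableOn (fun y => F (W y + H (r⁻¹ • (y - x)))) B volume :=
    hF.integrableOn hB (hW.add hHm) hb1
  have hi2 : IntegrableOn (fun y => F (W x + H (r⁻¹ • (y - x)))) B volume :=
    hF.integrableOn hB (aestronglyMeasurable_const.add hHm) hb2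
  have hi3 : IntegrableOn (fun y => ‖W y - W x‖) B volume :=
    Measure.integrableOn_of_bounded (M := M + M) hB (hW.sub aestronglyMeasurable_const).norm
      (ae_restrict_of_ae (by
        filter_upwards [hWM] with y hy
        rw [norm_norm]
        exact (norm_sub_le _ _).trans (add_le_add hy hx)))
  have s1 : ∫ y in B, F (W y + H (r⁻¹ • (y - x))) ≤
      ∫ y in B, (F (W x + H (r⁻¹ • (y - x))) + L * ‖W y - W x‖) := by
    refine integral_mono_ae hi1 (hi2.add (hi3.const_mul L)) (ae_restrict_of_ae ?_)
    filter_upwards [hb1, hb2] with y hy1 hy2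
    have := (abs_le.1 (hLip _ _ hy1 hy2)).2
    rw [add_sub_add_right_eq_sub] at this
    linarith
  rw [integral_add hi2 (hi3.const_mul L), integral_const_mul,
    setIntegral_closedBall_comp_inv_smul_sub hr x (fun z => F (W x + H z))] at s1
  have s2 : r ^ n * ∫ z in Metric.ball (0 : Eucl n) 1, F (W x + H z) ≤
      r ^ n * (g x + β * ε / 3) := by gcongr
  have s3 : L * ∫ y in B, ‖W y - W x‖ ≤ volume.real B * (ε / 3) := by
    rw [setAverage_eq, smul_eq_mul] at h1
    have := mul_le_mul_of_nonneg_left h1.le hvol0.le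
    rwa [mul_left_comm L, mul_inv_cancel_left₀ hvol0.ne'] at this
  have hgB : IntegrableOn g B volume := hg.integrableOn_isCompact (isCompact_closedBall _ _)
  have s4 : volume.real B * g x ≤ (∫ y in B, g y) + volume.real B * (β * ε / 3) := by
    have hc : IntegrableOn (fun _ : Eucl n => g x) B volume := integrableOn_const hB
    have e1 : ∫ y in B, (g y - g x) = (∫ y in B, g y) - volume.real B * g x := by
      rw [integral_sub hgB hc, setIntegral_const, smul_eq_mul]
    have e2 : ‖∫ y in B, (g y - g x)‖ ≤ ∫ y in B, ‖g y - g x‖ :=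
      norm_integral_le_integral_norm _
    rw [Real.norm_eq_abs] at e2
    rw [setAverage_eq, smul_eq_mul] at h2
    have e3 := mul_le_mul_of_nonneg_left h2.le hvol0.le
    rw [mul_inv_cancel_left₀ hvol0.ne'] at e3
    have := (abs_le.1 (e2.trans e3)).1
    rw [e1] at this
    linarith
  have s5 : r ^ n * g x ≤ β⁻¹ * (∫ y in B, g y) + volume.real B * (ε / 3) := by
    have := mul_le_mul_of_nonneg_left s4 (inv_pos.2 hβ0).le
    calc r ^ n * g x = β⁻¹ * (volume.real B * g x) := by rw [hvol]; field_simp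
      _ ≤ _ := this
      _ = _ := by field_simp
  have s6 : r ^ n * (β * ε / 3) = volume.real B * (ε / 3) := by rw [hvol]; ring
  rw [mul_add, s6] at s2
  linarith

end Envelope

/-! ### Relaxation by patching on balls, and quasiconvexity of the envelope -/

section Relaxation

variable {n : ℕ} {F : Mat n → ℝ} {U : Set (Eucl n)}

/-- The Besicovitch theorem covers almost all of `U` by countably many disjoint balls of good
radius; as `U` has finite measure, continuity from above lets finitely many suffice. -/
theorem exists_finset_disjoint_closedBall_cover (hU : IsOpen U) (hUb : Bornology.IsBounded U)
    {good : Eucl n → Set ℝ} (hgood : ∀ᵐ x, ∀ᶠ r in 𝓝[>] (0 : ℝ), r ∈ good x) {η : ℝ}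
    (hη : 0 < η) :
    ∃ (s : Finset (Eucl n)) (ρ : Eucl n → ℝ),
      (∀ x ∈ s, 0 < ρ x ∧ ρ x ∈ good x ∧ Metric.closedBall x (ρ x) ⊆ U) ∧
      (s : Set (Eucl n)).PairwiseDisjoint (fun x => Metric.closedBall x (ρ x)) ∧
      volume.real (U \ ⋃ x ∈ s, Metric.closedBall x (ρ x)) ≤ η := by
  classical
  let S : Set (Eucl n) := {x | x ∈ U ∧ ∀ᶠ r in 𝓝[>] (0 : ℝ), r ∈ good x}
  let f : Eucl n → Set ℝ := fun x => {r | r ∈ good x ∧ Metric.closedBall x r ⊆ U}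
  have hf : ∀ x ∈ S, ∀ δ > 0, (f x ∩ Set.Ioo 0 δ).Nonempty := by
    rintro x ⟨hxU, hx⟩ δ hδ
    obtain ⟨r₀, hr₀, hr₀U⟩ := Metric.nhds_basis_closedBall.mem_iff.1 (hU.mem_nhds hxU)
    have hIoo : ∀ᶠ r in 𝓝[>] (0 : ℝ), r ∈ Set.Ioo 0 (min δ r₀) :=
      Ioo_mem_nhdsGT (lt_min hδ hr₀)
    obtain ⟨r, hr1, hr2⟩ := (hx.and hIoo).exists
    exact ⟨r, ⟨hr1, (Metric.closedBall_subset_closedBall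
      (hr2.2.le.trans (min_le_right _ _))).trans hr₀U⟩, hr2.1, hr2.2.trans_le (min_le_left _ _)⟩
  obtain ⟨t, ρ, htc, htS, htρ, htcov, htd⟩ :=
    Besicovitch.exists_disjoint_closedBall_covering_ae volume f S hf (fun _ => 1)
      (fun _ _ => one_pos)
  have hUcov : volume (U \ ⋃ x ∈ t, Metric.closedBall x (ρ x)) = 0 := by
    refine measure_mono_null (t := (S \ ⋃ x ∈ t, Metric.closedBall x (ρ x)) ∪
      {x | ¬ ∀ᶠ r in 𝓝[>] (0 : ℝ), r ∈ good x}) ?_ (measure_union_null htcov (ae_iff.1 hgood))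
    rintro x ⟨hxU, hx⟩
    by_cases h : ∀ᶠ r in 𝓝[>] (0 : ℝ), r ∈ good x
    · exact Or.inl ⟨⟨hxU, h⟩, hx⟩
    · exact Or.inr h
  have : Countable t := htc.to_subtype
  let V : Finset t → Set (Eucl n) := fun s => U \ ⋃ x ∈ s, Metric.closedBall x.1 (ρ x.1)
  have hVm : ∀ s, MeasurableSet (V s) := fun s =>
    hU.measurableSet.diff (Finset.measurableSet_biUnion _ fun _ _ => measurableSet_closedBall)
  have hVanti : Antitone V := fun s s' hss' =>
    Set.sdiff_subset_sdiff_right (Set.biUnion_subset_biUnion_left fun x hx => hss' hx)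
  have hlim := tendsto_measure_iInter_atTop (μ := volume)
    (fun s => (hVm s).nullMeasurableSet) hVanti
    ⟨∅, ((measure_mono Set.sdiff_subset).trans_lt hUb.measure_lt_top).ne⟩
  have hV0 : volume (⋂ s, V s) = 0 := by
    refine measure_mono_null ?_ hUcov
    intro x hx
    rw [Set.mem_iInter] at hx
    refine ⟨(hx ∅).1, fun hmem => ?_⟩
    obtain ⟨y, hy, hxy⟩ := Set.mem_iUnion₂.1 hmem
    exact (hx {⟨y, hy⟩}).2 (Set.mem_iUnion₂.2 ⟨⟨y, hy⟩, Finset.mem_singleton_self _, hxy⟩)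
  rw [hV0] at hlim
  obtain ⟨s, hs⟩ := (hlim.eventually (gt_mem_nhds (ENNReal.ofReal_pos.2 hη))).exists
  have hmem : ∀ x ∈ s.image Subtype.val, x ∈ t := by
    intro x hx
    obtain ⟨y, -, rfl⟩ := Finset.mem_image.1 hx
    exact y.2
  refine ⟨s.image Subtype.val, ρ, fun x hx => ?_, fun x hx y hy hxy =>
    htd (hmem x hx) (hmem y hy) hxy, ?_⟩
  · have h := htρ x (hmem x hx)
    exact ⟨h.2.1, h.1.1, h.1.2⟩
  · rw [Finset.set_biUnion_finset_image]
    exact ENNReal.toReal_le_of_le_ofReal hη.le hs.le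

/-- Relaxation: every bounded measurable field `W` can be perturbed by a test gradient so that
the energy `∫_U F` comes down to that of the quasiconvex envelope. -/
theorem exists_setIntegral_le_qcEnvelope_add (hF0 : ∀ X, 0 ≤ F X) (hF : LipschitzOnBounded F)
    (hU : IsOpen U) (hUb : Bornology.IsBounded U) {W : Eucl n → Mat n}
    (hW : AEStronglyMeasurable W volume) {M : ℝ} (hWM : ∀ᵐ y, ‖W y‖ ≤ M) {ε : ℝ} (hε : 0 < ε) :
    ∃ (ψ : Eucl n → Eucl n) (H : Eucl n → Mat n), MemW1InftyZero U ψ H ∧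
      (∀ᵐ x, x ∉ U → H x = 0) ∧
      ∫ x in U, F (W x + H x) ≤
        (volume.real (Metric.ball (0 : Eucl n) 1))⁻¹ * (∫ x in U, qcEnvelope F (W x)) + ε := by
  set β := volume.real (Metric.ball (0 : Eucl n) 1) with hβ
  have hβ0 : 0 < β := ENNReal.toReal_pos (Metric.measure_ball_pos volume _ one_pos).ne'
    measure_ball_lt_top.ne
  obtain ⟨N, hN0, hN⟩ := hF.exists_bound M
  set g : Eucl n → ℝ := fun x => qcEnvelope F (W x) with hg
  have hg0 : ∀ x, 0 ≤ g x := fun x => qcEnvelope_nonneg hF0 _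
  have hgN : ∀ᵐ x, ‖g x‖ ≤ β * N := by
    filter_upwards [hWM] with x hx
    rw [Real.norm_of_nonneg (hg0 x)]
    refine (qcEnvelope_le_const hF0 _).trans ?_
    gcongr
    exact (le_abs_self _).trans (hN _ hx)
  have hgm : AEStronglyMeasurable g volume :=
    ((measurable_qcEnvelope hF0 hF).comp_aemeasurable hW.aemeasurable).aestronglyMeasurable
  have hgl : LocallyIntegrable g volume :=
    (memLp_top_of_bound hgm _ hgN).locallyIntegrable le_top
  have hWl : LocallyIntegrable W volume :=
    (memLp_top_of_bound hW _ hWM).locallyIntegrable le_top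
  have hUfin : volume U ≠ ⊤ := hUb.measure_lt_top.ne
  -- Half of `ε` is spent on the balls, as `ε₁ |U|`, and half on the uncovered part, as `N η`; the
  -- added 1 keeps the denominators positive.
  set ε₁ := ε / (2 * (volume.real U + 1)) with hε₁
  have hε₁0 : 0 < ε₁ := by positivity
  -- No measurability in `x` is needed: only the finitely many centres of the balls will be used.
  choose ψ H hψH hopt using fun x => exists_integral_lt_qcEnvelope_add (F := F) (W x)
    (show 0 < β * ε₁ / 3 by positivity)
  have hgood : ∀ᵐ x, ∀ᶠ r in 𝓝[>] (0 : ℝ), r ∈ {r : ℝ |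
      ∫ y in Metric.closedBall x r, F (W y + H x (r⁻¹ • (y - x))) ≤
        β⁻¹ * (∫ y in Metric.closedBall x r, g y) +
          ε₁ * volume.real (Metric.closedBall x r)} := by
    filter_upwards [hWM, (Besicovitch.vitaliFamily volume).ae_tendsto_average_norm_sub hWl,
      (Besicovitch.vitaliFamily volume).ae_tendsto_average_norm_sub hgl] with x hx h1 h2
    obtain ⟨M', hM'⟩ := (hψH x).1.ae_norm_grad_le
    exact eventually_setIntegral_closedBall_le hF hW hWM (hψH x).1.aestronglyMeasurable_grad hM'
      hgl hx (h1.comp (Besicovitch.tendsto_filterAt volume x))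
      (h2.comp (Besicovitch.tendsto_filterAt volume x)) hε₁0 (hopt x).le
  set η := ε / (2 * (N + 1)) with hη
  have hη0 : 0 < η := by positivity
  obtain ⟨s, ρ, hs, hdisj, hsmall⟩ :=
    exists_finset_disjoint_closedBall_cover hU hUb hgood hη0
  set B : Eucl n → Set (Eucl n) := fun x => Metric.closedBall x (ρ x) with hB
  set V := ⋃ x ∈ s, B x with hV
  have hVU : V ⊆ U := Set.iUnion₂_subset fun x hx => (hs x hx).2.2
  have hVm : MeasurableSet V := Finset.measurableSet_biUnion _ fun _ _ => measurableSet_closedBall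
  have hball : ∀ x ∈ s, MemW1InftyZero (Metric.ball x (ρ x))
      (fun y => ρ x • ψ x ((ρ x)⁻¹ • (y - x))) (fun y => H x ((ρ x)⁻¹ • (y - x))) :=
    fun x hx => (hψH x).comp_inv_smul_sub (hs x hx).1 x
  set H' : Eucl n → Mat n := fun y => ∑ x ∈ s, H x ((ρ x)⁻¹ • (y - x)) with hH'
  have hmem : MemW1InftyZero U (fun y => ∑ x ∈ s, ρ x • ψ x ((ρ x)⁻¹ • (y - x))) H' :=
    MemW1InftyZero.sum s fun x hx =>
      (hball x hx).mono (Metric.ball_subset_closedBall.trans (hs x hx).2.2)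
  have hvanish : ∀ᵐ y, ∀ x ∈ s, y ∉ B x → H x ((ρ x)⁻¹ • (y - x)) = 0 := by
    rw [Filter.eventually_all_finset]
    exact fun x hx => (hball x hx).grad_ae_eq_zero Metric.isClosed_closedBall
      Metric.ball_subset_closedBall
  have hoff : ∀ᵐ y, y ∉ V → H' y = 0 := by
    filter_upwards [hvanish] with y hy hyV
    exact Finset.sum_eq_zero fun x hx => hy x hx fun hyx => hyV (Set.mem_iUnion₂.2 ⟨x, hx, hyx⟩)
  have hon : ∀ x ∈ s, ∀ᵐ y, y ∈ B x → H' y = H x ((ρ x)⁻¹ • (y - x)) := by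
    intro x hx
    filter_upwards [hvanish] with y hy hyx
    refine Finset.sum_eq_single_of_mem x hx fun x' hx' hne => hy x' hx' fun hyx' => ?_
    exact Set.disjoint_left.1 (hdisj hx' hx hne) hyx' hyx
  refine ⟨_, H', hmem, hoff.mono fun y hy hyU => hy fun hyV => hyU (hVU hyV), ?_⟩
  obtain ⟨M', hM'⟩ := hmem.1.ae_norm_grad_le
  have hint : IntegrableOn (fun y => F (W y + H' y)) U volume :=
    hF.integrableOn hUfin (hW.add hmem.1.aestronglyMeasurable_grad) (R := M + M') (by
      filter_upwards [hWM, hM'] with y h1 h2 using (norm_add_le _ _).trans (add_le_add h1 h2))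
  have hgU : IntegrableOn g U volume :=
    Measure.integrableOn_of_bounded hUfin hgm (ae_restrict_of_ae hgN)
  have hdisj' : Set.Pairwise (s : Set (Eucl n)) (Function.onFun Disjoint B) := hdisj
  have hsplit := integral_inter_add_sdiff hVm hint
  rw [Set.inter_eq_self_of_subset_right hVU] at hsplit
  have hsum : ∫ y in V, F (W y + H' y) ≤ β⁻¹ * (∫ y in U, g y) + ε₁ * volume.real U := by
    rw [hV, integral_biUnion_finset s (fun _ _ => measurableSet_closedBall) hdisj'
      fun x hx => hint.mono_set (hs x hx).2.2]
    have h1 : ∀ x ∈ s, ∫ y in B x, F (W y + H' y) ≤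
        β⁻¹ * (∫ y in B x, g y) + ε₁ * volume.real (B x) := by
      intro x hx
      refine le_trans (le_of_eq ?_) (hs x hx).2.1
      refine setIntegral_congr_ae measurableSet_closedBall ?_
      filter_upwards [hon x hx] with y hy hyx
      rw [hy hyx]
    refine (Finset.sum_le_sum h1).trans ?_
    rw [Finset.sum_add_distrib, ← Finset.mul_sum, ← Finset.mul_sum,
      ← integral_biUnion_finset s (fun _ _ => measurableSet_closedBall) hdisj'
        (fun x hx => hgU.mono_set (hs x hx).2.2),
      ← measureReal_biUnion_finset hdisj (fun _ _ => measurableSet_closedBall)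
        (fun _ _ => measure_closedBall_lt_top.ne)]
    have h2 : ∫ y in V, g y ≤ ∫ y in U, g y :=
      setIntegral_mono_set hgU (ae_of_all _ hg0) hVU.eventuallyLE
    have h3 : volume.real V ≤ volume.real U := measureReal_mono hVU hUfin
    gcongr
  have hrest : ∫ y in U \ V, F (W y + H' y) ≤ N * η := by
    have hfin : volume (U \ V) < ⊤ := (measure_mono Set.sdiff_subset).trans_lt hUb.measure_lt_top
    have h1 : ‖∫ y in U \ V, F (W y + H' y)‖ ≤ N * volume.real (U \ V) := by
      refine norm_setIntegral_le_of_norm_le_const_ae hfin ?_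
      rw [ae_restrict_iff' (hU.measurableSet.diff hVm)]
      filter_upwards [hoff, hWM] with y hy1 hy2 hyV
      rw [hy1 hyV.2, add_zero]
      exact hN _ hy2
    exact (Real.le_norm_self _).trans (h1.trans (by gcongr))
  have e1 : ε₁ * volume.real U ≤ ε / 2 := by
    have hv : 0 ≤ volume.real U := measureReal_nonneg
    rw [hε₁, div_mul_eq_mul_div, div_le_div_iff₀ (by positivity) (by positivity)]
    nlinarith
  have e2 : N * η ≤ ε / 2 := by
    rw [hη, ← mul_div_assoc, div_le_div_iff₀ (by positivity) (by positivity)]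
    nlinarith
  linarith

/-- Relaxing the field `A + ∇φ` on the ball produces `ψ` whose energy is nearly the integral of the
envelope, and `φ + ψ` is a competitor in the infimum at `A`. -/
theorem isQuasiconvex_qcEnvelope (hF0 : ∀ X, 0 ≤ F X) (hF : LipschitzOnBounded F) :
    IsQuasiconvex (qcEnvelope F) where
  borel_measurable := measurable_qcEnvelope hF0 hF
  locally_bounded R := by
    obtain ⟨N, hN0, hN⟩ := hF.exists_bound R
    refine ⟨volume.real (Metric.ball (0 : Eucl n) 1) * N, fun A hA => ?_⟩
    rw [abs_of_nonneg (qcEnvelope_nonneg hF0 A)]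
    refine (qcEnvelope_le_const hF0 A).trans ?_
    gcongr
    exact (le_abs_self _).trans (hN A hA)
  le_integral A φ G h := by
    set β := volume.real (Metric.ball (0 : Eucl n) 1) with hβ
    have hβ0 : 0 < β := ENNReal.toReal_pos (Metric.measure_ball_pos volume _ one_pos).ne'
      measure_ball_lt_top.ne
    obtain ⟨M, hM⟩ := h.1.ae_norm_grad_le
    have key : qcEnvelope F A ≤
        β⁻¹ * ∫ x in Metric.ball (0 : Eucl n) 1, qcEnvelope F (A + G x) := by
      refine le_of_forall_pos_le_add fun ε hε => ?_
      obtain ⟨ψ, H, hψ, -, hle⟩ := exists_setIntegral_le_qcEnvelope_add hF0 hF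
        (Metric.isOpen_ball (x := (0 : Eucl n)) (ε := 1)) Metric.isBounded_ball
        (W := fun x => A + G x) (aestronglyMeasurable_const.add h.1.aestronglyMeasurable_grad)
        (M := ‖A‖ + M) (hM.mono fun x hx => (norm_add_le _ _).trans (by linarith)) hε
      refine le_trans (qcEnvelope_le hF0 A (h.add hψ)) ?_
      simpa only [add_assoc] using hle
    have := mul_le_mul_of_nonneg_left key hβ0.le
    rwa [mul_inv_cancel_left₀ hβ0.ne'] at this

end Relaxation

/-! ### The quasiconvex hull of `K` -/

section QuasiconvexHull

variable {n : ℕ} {U : Set (Eucl n)} {K : Set (Mat n)} {p : ℝ}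

theorem abs_rpow_sub_rpow_le (hp : 1 ≤ p) {R a b : ℝ} (ha : 0 ≤ a) (haR : a ≤ R) (hb : 0 ≤ b)
    (hbR : b ≤ R) : |a ^ p - b ^ p| ≤ p * R ^ (p - 1) * |a - b| := by
  refine Convex.norm_image_sub_le_of_norm_hasDerivWithin_le (𝕜 := ℝ) (s := Set.Icc 0 R)
    (f := fun x : ℝ => x ^ p) (f' := fun x => p * x ^ (p - 1))
    (fun x _ => (Real.hasDerivAt_rpow_const (Or.inr hp)).hasDerivWithinAt) (fun x hx => ?_)
    (convex_Icc 0 R) ⟨hb, hbR⟩ ⟨ha, haR⟩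
  have h0 : 0 ≤ x ^ (p - 1) := Real.rpow_nonneg hx.1 _
  rw [Real.norm_of_nonneg (by positivity)]
  exact mul_le_mul_of_nonneg_left (Real.rpow_le_rpow hx.1 hx.2 (by linarith)) (by linarith)

theorem lipschitzOnBounded_infDist_rpow (hK_ne : K.Nonempty) (hp : 1 ≤ p) :
    LipschitzOnBounded fun X => Metric.infDist X K ^ p := by
  obtain ⟨B, hB⟩ := hK_ne
  intro R
  have hle : ∀ X : Mat n, ‖X‖ ≤ R → Metric.infDist X K ≤ |R| + ‖B‖ := fun X hX => by
    refine (Metric.infDist_le_dist_of_mem hB).trans ?_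
    rw [dist_eq_norm]
    exact (norm_sub_le _ _).trans (by linarith [le_abs_self R])
  refine ⟨p * (|R| + ‖B‖) ^ (p - 1), by positivity, fun X Y hX hY => ?_⟩
  refine (abs_rpow_sub_rpow_le hp Metric.infDist_nonneg (hle X hX) Metric.infDist_nonneg
    (hle Y hY)).trans ?_
  have h1 := (Metric.lipschitz_infDist_pt K).dist_le_mul X Y
  rw [Real.dist_eq, dist_eq_norm, NNReal.coe_one, one_mul] at h1
  gcongr

theorem memW1_mat_apply (hUo : IsOpen U) (hU : Bornology.IsBounded U) (A : Mat n) :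
    MemW1 ∞ U (Mat.apply A) (fun _ => A) := by
  refine ⟨?_, memLp_top_const A, hasWeakGradient_mat_apply A⟩
  obtain ⟨M, hM⟩ := (hU.isCompact_closure.image A.continuous_apply).isBounded.exists_norm_le
  refine memLp_top_of_bound A.continuous_apply.aestronglyMeasurable M ?_
  exact (ae_restrict_iff' hUo.measurableSet).2
    (ae_of_all _ fun x hx => hM _ ⟨x, subset_closure hx, rfl⟩)

theorem subset_quasiconvexHull (hK : IsCompact K) : K ⊆ quasiconvexHull K := by
  intro A hA f hf
  obtain ⟨R, hR⟩ := hK.isBounded.exists_norm_le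
  obtain ⟨M, hM⟩ := hf.locally_bounded R
  refine le_csSup ⟨M, ?_⟩ ⟨A, hA, rfl⟩
  rintro _ ⟨B, hB, rfl⟩
  exact (le_abs_self _).trans (hM B (hR B hB))

theorem QuantRigidityEstimate.quasiconvexHull_eq (hU : IsBoundedLipschitzDomain U)
    (hK : IsCompact K) (hK_ne : K.Nonempty) (hp : 1 < p)
    (hrig : QuantRigidityEstimate (ENNReal.ofReal p) U K) : quasiconvexHull K = K := by
  refine Set.Subset.antisymm (fun A hA => ?_) (subset_quasiconvexHull hK)
  obtain ⟨C, hC, hest⟩ := hrig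
  set F : Mat n → ℝ := fun X => Metric.infDist X K ^ p with hFdef
  have hF0 : ∀ X, 0 ≤ F X := fun X => Real.rpow_nonneg Metric.infDist_nonneg _
  have hF : LipschitzOnBounded F := lipschitzOnBounded_infDist_rpow hK_ne hp.le
  have hp0 : 0 < p := by linarith
  have hFK : ∀ X ∈ K, qcEnvelope F X = 0 := by
    intro X hX
    refine le_antisymm ((qcEnvelope_le_const hF0 X).trans (le_of_eq ?_)) (qcEnvelope_nonneg hF0 X)
    simp [hFdef, Metric.infDist_zero_of_mem hX, Real.zero_rpow hp0.ne']
  -- The envelope is used as the separating quasiconvex function: its supremum over `K` is zero.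
  have hA0 : qcEnvelope F A = 0 := by
    refine le_antisymm ((hA _ (isQuasiconvex_qcEnvelope hF0 hF)).trans (le_of_eq ?_))
      (qcEnvelope_nonneg hF0 A)
    have : qcEnvelope F '' K = {0} := by
      rw [Set.image_congr hFK, hK_ne.image_const]
    rw [this, csSup_singleton]
  have hfin : IsFiniteMeasure (volume.restrict U) := ⟨by simpa using hU.isBounded.measure_lt_top⟩
  set P := ENNReal.ofReal p with hP
  have hPr : P.toReal = p := ENNReal.toReal_ofReal hp0.le
  have hP1 : 1 ≤ P := by rw [hP, ← ENNReal.ofReal_one]; exact ENNReal.ofReal_le_ofReal hp.le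
  have hP0 : P ≠ 0 := (zero_lt_one.trans_le hP1).ne'
  have hvol0 : volume U ≠ 0 := (hU.isOpen.measure_pos volume hU.isConnected.nonempty).ne'
  have hvol : volume U ≠ ⊤ := hU.isBounded.measure_lt_top.ne
  -- The constant of the estimate times the Hölder factor for passing from `L^p` to `L¹` on `U`.
  set c := ENNReal.ofReal C * volume U ^ (1 / (1 : ℝ≥0∞).toReal - 1 / P.toReal) with hc
  have hc_top : c ≠ ⊤ := by
    refine ENNReal.mul_ne_top ENNReal.ofReal_ne_top (ENNReal.rpow_ne_top_of_nonneg ?_ hvol)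
    rw [hPr, ENNReal.toReal_one, div_one, sub_nonneg, div_le_one hp0]
    exact hp.le
  have key : ∀ ε : ℝ, 0 < ε →
      ENNReal.ofReal (Metric.infDist A K) * volume U ≤ c * ENNReal.ofReal (ε ^ p⁻¹) := by
    intro ε hε
    obtain ⟨ψ, H, hψ, hHU, hle⟩ := exists_setIntegral_le_qcEnvelope_add hF0 hF hU.isOpen
      hU.isBounded (W := fun _ => A) aestronglyMeasurable_const (M := ‖A‖)
      (ae_of_all _ fun _ => le_rfl) hε
    simp only [hA0, integral_zero, mul_zero, zero_add] at hle
    have hu : MemW1 ∞ U (fun x => Mat.apply A x + ψ x) (fun x => A + H x) :=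
      (memW1_mat_apply hU.isOpen hU.isBounded A).add hψ.1.restrict
    obtain ⟨A', hA'K, hA'⟩ := hest _ _ (hu.mono_exponent hU.isBounded P)
    have hm : AEStronglyMeasurable (fun x => A + H x) (volume.restrict U) := hu.memLp_grad.1
    have hHi : Integrable H (volume.restrict U) := hψ.1.restrict.memLp_grad.integrable le_top
    have hd : MemLp (fun x => Metric.infDist (A + H x) K) P (volume.restrict U) := by
      obtain ⟨B, hB⟩ := hK_ne
      have h1 : MemLp (fun x => A + H x - B) P (volume.restrict U) :=
        (hu.memLp_grad.mono_exponent le_top).sub (memLp_const B)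
      refine h1.mono ((Metric.continuous_infDist_pt K).comp_aestronglyMeasurable hm)
        (ae_of_all _ fun x => ?_)
      rw [Real.norm_of_nonneg Metric.infDist_nonneg, ← dist_eq_norm]
      exact Metric.infDist_le_dist_of_mem hB
    have hdε : eLpNorm (fun x => Metric.infDist (A + H x) K) P (volume.restrict U) ≤
        ENNReal.ofReal (ε ^ p⁻¹) := by
      rw [hd.eLpNorm_eq_integral_rpow_norm hP0 ENNReal.ofReal_ne_top, hPr]
      simp only [Real.norm_of_nonneg Metric.infDist_nonneg]
      exact ENNReal.ofReal_le_ofReal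
        (Real.rpow_le_rpow (integral_nonneg fun x => hF0 _) hle (by positivity))
    -- The test gradient has mean zero, so averaging removes it and leaves the distance between the
    -- two matrices.
    have hmean : ∫ x in U, (A + H x - A') = volume.real U • (A - A') := by
      have h0 := hψ.integral_grad_eq_zero hU.isBounded hHU
      have hAH : Integrable (fun x => A + H x) (volume.restrict U) := (integrable_const A).add hHi
      rw [integral_sub hAH (integrable_const A'),
        integral_add (integrable_const A) hHi, h0, setIntegral_const, setIntegral_const,
        add_zero, smul_sub]
    have hdist : ENNReal.ofReal (Metric.infDist A K) ≤ ‖A - A'‖ₑ := by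
      rw [← ofReal_norm, ← dist_eq_norm]
      exact ENNReal.ofReal_le_ofReal (Metric.infDist_le_dist_of_mem hA'K)
    calc ENNReal.ofReal (Metric.infDist A K) * volume U
        ≤ ‖A - A'‖ₑ * volume U := by gcongr
      _ = ‖∫ x in U, (A + H x - A')‖ₑ := by
        rw [hmean, enorm_smul, mul_comm, measureReal_def, Real.enorm_eq_ofReal (by positivity),
          ENNReal.ofReal_toReal hvol]
      _ ≤ eLpNorm (fun x => A + H x - A') 1 (volume.restrict U) := by
        rw [eLpNorm_one_eq_lintegral_enorm]
        exact enorm_integral_le_lintegral_enorm _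
      _ ≤ eLpNorm (fun x => A + H x - A') P (volume.restrict U) *
          volume U ^ (1 / (1 : ℝ≥0∞).toReal - 1 / P.toReal) := by
        simpa only [Measure.restrict_apply_univ] using eLpNorm_le_eLpNorm_mul_rpow_measure_univ
          (f := fun x => A + H x - A') hP1 (hm.sub aestronglyMeasurable_const)
      _ ≤ ENNReal.ofReal C * ENNReal.ofReal (ε ^ p⁻¹) *
          volume U ^ (1 / (1 : ℝ≥0∞).toReal - 1 / P.toReal) := by
        gcongr
        exact hA'.trans (by gcongr)
      _ = c * ENNReal.ofReal (ε ^ p⁻¹) := by rw [hc]; ring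
  have hlim : Tendsto (fun ε : ℝ => c * ENNReal.ofReal (ε ^ p⁻¹)) (𝓝[>] 0) (𝓝 0) := by
    have h1 : Tendsto (fun ε : ℝ => ε ^ p⁻¹) (𝓝[>] 0) (𝓝 0) := by
      have := (Real.continuous_rpow_const (inv_pos.2 hp0).le).tendsto 0
      rw [Real.zero_rpow (inv_pos.2 hp0).ne'] at this
      exact this.mono_left nhdsWithin_le_nhds
    have h2 := ENNReal.tendsto_ofReal h1
    rw [ENNReal.ofReal_zero] at h2
    simpa using ENNReal.Tendsto.const_mul h2 (Or.inr hc_top)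
  have hle0 : ENNReal.ofReal (Metric.infDist A K) * volume U ≤ 0 :=
    ge_of_tendsto hlim (eventually_nhdsWithin_of_forall fun ε hε => key ε hε)
  rw [nonpos_iff_eq_zero, mul_eq_zero, or_iff_left hvol0, ENNReal.ofReal_eq_zero] at hle0
  exact (hK.isClosed.mem_iff_infDist_zero hK_ne).2 (le_antisymm hle0 Metric.infDist_nonneg)

end QuasiconvexHull

theorem lemmal (n : ℕ) (hn : 1 ≤ n) (U : Set (Eucl n)) (hU : IsBoundedLipschitzDomain U)
    (K : Set (Mat n)) (hK : IsCompact K) (hK_ne : K.Nonempty)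
    (p : ℝ) (hp : 1 < p) (hpn : p * ((n : ℝ) - 1) < n)
    (hrig : QuantRigidityEstimate (ENNReal.ofReal p) U K) :
    RigidExact U K ∧ RigidApprox U K ∧ StronglyRigid U K ∧ quasiconvexHull K = K := by
  have hstrong := hrig.stronglyRigid hU hK_ne hp
  exact ⟨hrig.rigidExact hU hp, hstrong.rigidApprox, hstrong,
    hrig.quasiconvexHull_eq hU hK hK_ne hp⟩
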